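/- A stationary stochastic process $P$ is a shift-invariant probability law on two-sided sequences $\dots x_{-1}x_0x_1\dots$ over a finite alphabet; its time reversal $P^-$ is the law of $Y_t=X_{-(t+1)}$. Two pasts $\dots x_{-2}x_{-1}$ lie in the same causal state if they have the same conditional law of the future $x_0x_1\dots$. If the causal states have probabilities $\pi_i$, then $C_\mu(P)=-\sum_i\pi_i\log_2\pi_i$ (infinite if the causal states of positive probability do not exhaust the pasts up to probability zero). Write $C_\mu^+=C_\mu(P)$, $C_\mu^-=C_\mu(P^-)$. A quantum model of $P$ consists of a complex Hilbert space, a (measurable) encoding $y\mapsto|f(y)\rangle$ of pasts into unit vectors and a quantum measurement process $\mathcal M=(\mathcal M_x)_x$ (completely positive maps given by Kraus operators, $\mathcal M_x(\rho)=\sum_k K_{x,k}\rho K_{x,k}^\dagger$, with $\sum_{x,k}K_{x,k}^\dagger K_{x,k}=1$) such that for almost every past $y$ and every symbol $x$, $\mathcal M_x(|f(y)\rangle\langle f(y)|)=P(X_0=x\mid y)\,|f(yx)\rangle\langle f(yx)|$, i.e. the output is $x$ with the correct conditional probability, and the memory is then in the state of the extended past $yx$. Its entropy is $S(\rho)=-\mathrm{Tr}(\rho\log_2\rho)$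 with $\rho=\int|f(y)\rangle\langle f(y)|\,dP(y)$. A model is optimal if no quantum model of $P$ has smaller entropy, and $C_q(P)$ is the infimum of the entropies of all quantum models of $P$; $C_q^+=C_q(P)$, $C_q^-=C_q(P^-)$. For $p,q\in[0,1]$ with $p+q>0$, the perturbed coin is the stationary two-sided Markov chain on $\{0,1\}$ that jumps from $0$ to $1$ with probability $p$ and from $1$ to $0$ with probability $q$. The heralding coin $\mathcal P_h^+$ is the process on $\{0,1,2\}$ obtained from it by replacing the first $0$ of each block of consecutive $0$s by a $2$. Let $\mathcal P_h^-$ be its time reversal, $h(x)=-x\log_2x-(1-x)\log_2(1-x)$, $\pi_1^+=p/(p+q)$, and $$c=\frac{p^2(1+4(1-q)q)-2pq+q^2}{(p+q)^2}.$$ **Theorem.** There is a stationary stochastic process with $C_\mu^+\neq C_\mu^-$ and $C_q^+=C_q^-$. Moreover, for all $p,q\in[0,1]$ with $p+q>0$, the heralding coin exists and satisfies the following. 1. $C_\mu^+=h(\pi_1^+)$, and if $0<p<1$ and $0<q<1$, then $C_\mu^+<C_\mu^-<\infty$. 2. Let $|s_0^+\rangle=\sqrt{1-p}\,|0\rangle+\sqrt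 p\,|1\rangle$ and $|s_1^+\rangle=\sqrt q\,|2\rangle+\sqrt{1-q}\,|1\rangle$. Encode a past into $|s_1^+\rangle$ if its last symbol is $1$ and into $|s_0^+\rangle$ otherwise; measure the memory in the computational basis, output the outcome $x$, and leave the memory in $|s_1^+\rangle$ if $x=1$ and in $|s_0^+\rangle$ otherwise (Kraus operators $|s_0^+\rangle\langle0|$, $|s_1^+\rangle\langle1|$, $|s_0^+\rangle\langle2|$ for the outputs $0,1,2$). This is an optimal quantum model of $\mathcal P_h^+$. 3. Let $|s_0^-\rangle=|0\rangle$, $|s_1^-\rangle=\sqrt q\,|0\rangle+\sqrt{1-q}\,|1\rangle$, $|s_2^-\rangle=|1\rangle$. Encode a past of $\mathcal P_h^-$ into $|s_j^-\rangle$ if its last symbol is $j$, with Kraus operators $\sqrt{1-p}\,|s_0^-\rangle\langle0|$, $|s_1^-\rangle\langle1|$, $\sqrt p\,|s_2^-\rangle\langle0|$ for the outputs $0,1,2$. This is an optimal quantum model of $\mathcal P_h^-$. 4. Both of these models have entropy $h\!\left(\frac{1+\sqrt c}{2}\right)$; thus $C_q^+=C_q^-=h\!\left(\frac{1+\sqrt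 c}{2}\right)$. -/

import Mathlib

open MeasureTheory ProbabilityTheory
open scoped ENNReal InnerProductSpace

noncomputable section

/-! ### Entropy functions (logarithms to base two, so that entropies are measured in bits) -/

/-- The function `x ↦ - x log₂ x` (equal to `0` at `x = 0`). -/
def eta (x : ℝ) : ℝ := -(x * Real.logb 2 x)

/-- Binary entropy `h(x) = - x log₂ x - (1 - x) log₂ (1 - x)`. -/
def binEnt (x : ℝ) : ℝ := eta x + eta (1 - x)

/-! ### Stochastic processes in discrete time, with a countable alphabet

A stochastic process is given by its law, a probability measure `P` on two-sided sequences
`… x₋₂ x₋₁ x₀ x₁ …`. -/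

section Basics

variable {A : Type}

/-- The past `… x₋₂ x₋₁` of a trajectory, listed backwards: entry `n` is `x₋₍ₙ₊₁₎`. -/
def past (x : ℤ → A) : ℕ → A := fun n => x (-((n : ℤ) + 1))

/-- The future `x₀ x₁ …` of a trajectory. -/
def future (x : ℤ → A) : ℕ → A := fun n => x (n : ℤ)

/-- The past `y x`, in which the symbol `x` was emitted after the past `y`. -/
def extendPast (y : ℕ → A) (x : A) : ℕ → A := fun n => Nat.casesOn n x y

/-- Time reversal of a trajectory, `Y_t = X_{-(t+1)}`: past and future are interchanged. -/
def reversePath (x : ℤ → A) : ℤ → A := fun t => x (-(t + 1))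

variable [MeasurableSpace A]

/-- The law of the time-reversed process. -/
def timeReversal (P : Measure (ℤ → A)) : Measure (ℤ → A) := P.map reversePath

/-- The law of the past. -/
def pastLaw (P : Measure (ℤ → A)) : Measure (ℕ → A) := P.map past

/-- Stationarity: the law is invariant under the shift by one time step. -/
def IsStationaryLaw (P : Measure (ℤ → A)) : Prop := P.map (fun x t => x (t + 1)) = P

variable [Countable A] [DiscreteMeasurableSpace A] [Nonempty A]

/-- The conditional law `P(future | past = y)` of the future, given the past `y`
(a regular conditional distribution, determined for almost every past `y`). -/
def futureGiven (P : Measure (ℤ → A)) [IsFiniteMeasure P] (y : ℕ → A) : Measure (ℕ → A) :=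
  condDistrib future past P y

/-- The conditional probability `P(X₀ = x | past = y)` of the next output. -/
def nextProb (P : Measure (ℤ → A)) [IsFiniteMeasure P] (y : ℕ → A) (x : A) : ℝ :=
  (futureGiven P y).real {z | z 0 = x}

/-! ### Causal states and classical statistical complexity -/

/-- The causal state belonging to the conditional future law `m`: the set of all pasts whose
conditional future law is `m`. Two pasts lie in the same causal state if and only if
their conditional futures coincide. -/
def causalState (P : Measure (ℤ → A)) [IsFiniteMeasure P] (m : Measure (ℕ → A)) :
    Set (ℕ → A) := {y | futureGiven P y = m}

open Classical in
/-- The classical statistical complexity `- ∑ᵢ πᵢ log πᵢ`, where `πᵢ` is the probability of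
the `i`-th causal state. It is infinite if the causal states of positive probability do not
exhaust the pasts up to probability zero. -/
def classicalComplexity (P : Measure (ℤ → A)) [IsFiniteMeasure P] : ℝ≥0∞ :=
  if ∑' m : Measure (ℕ → A), pastLaw P (causalState P m) = pastLaw P Set.univ then
    ∑' m : Measure (ℕ → A), ENNReal.ofReal (eta ((pastLaw P).real (causalState P m)))
  else ⊤

end Basics

/-! ### Quantum states, von Neumann entropy -/

section Quantum

variable {H : Type} [NormedAddCommGroup H] [InnerProductSpace ℂ H]

/-- The operator `|φ⟩⟨ψ|`. -/
def ketBra (φ ψ : H) : H →L[ℂ] H := InnerProductSpace.rankOne ℂ φ ψ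

variable [CompleteSpace H]

/-- The von Neumann entropy `S(ρ) = - Tr (ρ log ρ)` of a density operator `ρ` on a Hilbert space.
The positive operator `- ρ log ρ` is formed by functional calculus, and its trace, possibly
infinite, is computed in an orthonormal basis. -/
def vonNeumannEntropy (ρ : H →L[ℂ] H) : ℝ≥0∞ :=
  ∑' i, ENNReal.ofReal
    (RCLike.re ⟪(exists_hilbertBasis ℂ H).choose_spec.choose i,
      cfc eta ρ ((exists_hilbertBasis ℂ H).choose_spec.choose i)⟫_ℂ)

end Quantum

/-! ### Quantum causal models -/

section Models

/-- The data of a quantum causal model with outputs in `A` and memory system `H`: an encoding of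
pasts as vectors of `H` and, for each output `x`, the Kraus operators `kraus x k` of the
measurement process. The map `ρ ↦ ∑ₖ K_{x,k} ρ K_{x,k}†` gives the unnormalised state of the
memory after the output `x`, and its trace is the probability of `x`. The set of memory states is
the range of `encode`. -/
structure QuantumTuple (A : Type) (H : Type) [NormedAddCommGroup H] [InnerProductSpace ℂ H] where
  encode : (ℕ → A) → H
  Index : Type
  kraus : A → Index → (H →L[ℂ] H)

variable {A : Type} [MeasurableSpace A]
variable {H : Type} [NormedAddCommGroup H] [InnerProductSpace ℂ H]

/-- The averaged memory state `ρ = ∫ |f(y)⟩⟨f(y)| dP(y)`, over all pasts `y`. -/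
def QuantumTuple.averageState (Q : QuantumTuple A H) (P : Measure (ℤ → A)) : H →L[ℂ] H :=
  ∫ y, ketBra (Q.encode y) (Q.encode y) ∂(pastLaw P)

/-- The entropy of a quantum model: the von Neumann entropy of its averaged memory state. -/
def QuantumTuple.entropy [CompleteSpace H] (Q : QuantumTuple A H) (P : Measure (ℤ → A)) : ℝ≥0∞ :=
  vonNeumannEntropy (Q.averageState P)

variable [Countable A] [DiscreteMeasurableSpace A] [Nonempty A]

/-- `Q` is a quantum causal model of `P`. -/
structure QuantumTuple.IsModel (Q : QuantumTuple A H) (P : Measure (ℤ → A)) [IsFiniteMeasure P] :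
    Prop where
  /-- Pasts are encoded into pure states. -/
  norm_encode : ∀ y, ‖Q.encode y‖ = 1
  /-- The encoding of pasts into states is measurable. -/
  measurable_encode :
    AEStronglyMeasurable (fun y => ketBra (Q.encode y) (Q.encode y)) (pastLaw P)
  /-- The Kraus operators form a quantum measurement: `∑ₓₖ K_{x,k}† K_{x,k} = 1`. -/
  complete : ∀ ψ : H, HasSum (fun z : A × Q.Index => ‖Q.kraus z.1 z.2 ψ‖ ^ 2) (‖ψ‖ ^ 2)
  /-- Applied to the memory state of the past `y`, the measurement outputs `x` with
  probability `P(X₀ = x | past = y)`, and then leaves the memory in the state of the past `y x`. -/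
  step : ∀ᵐ y ∂(pastLaw P), ∀ x : A,
    HasSum (fun k => ketBra (Q.kraus x k (Q.encode y)) (Q.kraus x k (Q.encode y)))
      ((nextProb P y x : ℂ) •
        ketBra (Q.encode (extendPast y x)) (Q.encode (extendPast y x)))

/-- `Q` is an optimal quantum model of `P`: no model, on any Hilbert space, has smaller entropy. -/
def QuantumTuple.IsOptimal [CompleteSpace H] (Q : QuantumTuple A H) (P : Measure (ℤ → A))
    [IsFiniteMeasure P] : Prop :=
  Q.IsModel P ∧
    ∀ (K : Type) [NormedAddCommGroup K] [InnerProductSpace ℂ K] [CompleteSpace K]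
      (Q' : QuantumTuple A K), Q'.IsModel P → Q.entropy P ≤ Q'.entropy P

/-- The quantum statistical complexity: the infimum of the entropies of all quantum models. -/
def quantumComplexity (P : Measure (ℤ → A)) [IsFiniteMeasure P] : ℝ≥0∞ :=
  sInf {s | ∃ (K : Type) (_ : NormedAddCommGroup K) (_ : InnerProductSpace ℂ K)
    (_ : CompleteSpace K) (Q : QuantumTuple A K), Q.IsModel P ∧ Q.entropy P = s}

end Models

/-! ### The perturbed coin and the heralding coin -/

/-- Transition probabilities of the perturbed coin: it flips with probability `p` if it is in
state `0`, and with probability `q` if it is in state `1`. -/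
def coinTransition (p q : ℝ) : Fin 2 → Fin 2 → ℝ := ![![1 - p, p], ![q, 1 - q]]

/-- The stationary distribution of the perturbed coin. -/
def coinStationary (p q : ℝ) : Fin 2 → ℝ := ![q / (p + q), p / (p + q)]

/-- `ν` is the law of the stationary, two-sided perturbed coin process. -/
def IsPerturbedCoin (p q : ℝ) (ν : Measure (ℤ → Fin 2)) : Prop :=
  ∀ (t : ℤ) (n : ℕ) (w : ℕ → Fin 2),
    ν {b | ∀ i ≤ n, b (t + i) = w i} =
      ENNReal.ofReal (coinStationary p q (w 0) *
        ∏ i ∈ Finset.range n, coinTransition p q (w i) (w (i + 1)))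

/-- Replace the first `0` of each block of consecutive `0`s by a `2`. -/
def herald (b : ℤ → Fin 2) : ℤ → Fin 3 :=
  fun t => if b t = 1 then 1 else if b (t - 1) = 1 then 2 else 0

/-- The law of the heralding coin, obtained from the law `ν` of the perturbed coin. -/
def heraldingCoin (ν : Measure (ℤ → Fin 2)) : Measure (ℤ → Fin 3) := ν.map herald

instance (ν : Measure (ℤ → Fin 2)) [IsFiniteMeasure ν] : IsFiniteMeasure (heraldingCoin ν) := by
  unfold heraldingCoin; infer_instance

instance {A : Type} [MeasurableSpace A] (P : Measure (ℤ → A)) [IsFiniteMeasure P] :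
    IsFiniteMeasure (timeReversal P) := by
  unfold timeReversal; infer_instance

/-! ### The two quantum models of the heralding coin -/

/-- The computational basis of a `d`-level system. -/
def ket {d : ℕ} (i : Fin d) : EuclideanSpace ℂ (Fin d) := EuclideanSpace.single i 1

/-- `|s₀⁺⟩ = √(1-p) |0⟩ + √p |1⟩`. -/
def ketForward0 (p : ℝ) : EuclideanSpace ℂ (Fin 3) :=
  (√(1 - p) : ℂ) • ket 0 + (√p : ℂ) • ket 1

/-- `|s₁⁺⟩ = √q |2⟩ + √(1-q) |1⟩`. -/
def ketForward1 (q : ℝ) : EuclideanSpace ℂ (Fin 3) :=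
  (√q : ℂ) • ket 2 + (√(1 - q) : ℂ) • ket 1

/-- The quantum causal model: a past is encoded into `|s₁⁺⟩` if its last symbol is `1`, and
into `|s₀⁺⟩` otherwise. The memory is measured in the computational basis, with
outcome `x`, and a fresh system is prepared in `|s₁⁺⟩` if `x = 1`, and in `|s₀⁺⟩` otherwise. -/
def forwardModel (p q : ℝ) : QuantumTuple (Fin 3) (EuclideanSpace ℂ (Fin 3)) where
  encode y := if y 0 = 1 then ketForward1 q else ketForward0 p
  Index := Unit
  kraus x _ := ketBra (if x = 1 then ketForward1 q else ketForward0 p) (ket x)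

/-- `|s₀⁻⟩ = |0⟩`, `|s₁⁻⟩ = √q |0⟩ + √(1-q) |1⟩`, `|s₂⁻⟩ = |1⟩`. -/
def ketBackward (q : ℝ) : Fin 3 → EuclideanSpace ℂ (Fin 2) :=
  ![ket 0, (√q : ℂ) • ket 0 + (√(1 - q) : ℂ) • ket 1, ket 1]

/-- The quantum retrocausal model: a (reversed) past is encoded into `|s_j⁻⟩` if its last
symbol is `j`. One step is the isometry `|0⟩ ↦ √(1-p) |00⟩|0⟩ + √p |01⟩|1⟩`, `|1⟩ ↦ |10⟩|s₁⁻⟩`,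
followed by a measurement of the first two qubits, whose outcomes
`00`, `10`, `01` stand for the outputs `0`, `1`, `2`. -/
def backwardModel (p q : ℝ) : QuantumTuple (Fin 3) (EuclideanSpace ℂ (Fin 2)) where
  encode y := ketBackward q (y 0)
  Index := Unit
  kraus x _ := ![(√(1 - p) : ℂ) • ketBra (ketBackward q 0) (ket 0),
    ketBra (ketBackward q 1) (ket 1),
    (√p : ℂ) • ketBra (ketBackward q 2) (ket 0)] x

/-- `c = (p² (1 + 4 (1 - q) q) - 2 p q + q²) / (p + q)²`. -/
def coinC (p q : ℝ) : ℝ :=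
  (p ^ 2 * (1 + 4 * (1 - q) * q) - 2 * p * q + q ^ 2) / (p + q) ^ 2

end

/-!
The heralding coin and its time reversal are both stationary Markov chains on three symbols, so
everything about a past that matters for the future is its last symbol.

*Quantum part.* The Kraus operators of a model preserve inner products when summed over outputs.
Comparing the outputs that two memory states produce therefore bounds their overlap by the
Bhattacharyya coefficient of the two conditional laws of the next symbol
(`QuantumTuple.IsModel.norm_inner_encode_le`). The overlaps bound every Rayleigh quotient, hence
the largest eigenvalue `L`, of the average memory state (`integral_norm_inner_sq_le`). This bounds
the entropy: among all spectra of total weight one with no eigenvalue above `L ≥ 1/2`, the spectrum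
`(L, 1 - L)` has the least entropy (`binEnt_le_tsum_eta`). The memory may be infinite dimensional
and even non-separable, but its average state is a compact operator of trace one
(`hasSum_eigenvalues_integral_ketBra`). The two models of the theorem attain the overlap bound and
their memory states lie in a plane, so their spectrum is exactly `(L, 1 - L)`
(`vonNeumannEntropy_eq_binEnt`); hence they are optimal (`IsMarkovLaw.isOptimal_and_entropy_eq`).
Both have purity `(1 + c) / 2`, whence `L = (1 + √c) / 2` in either direction of time.

*Classical part.* For a Markov chain the causal state of a past is the row of the transition
matrix that belongs to its last symbol, so the statistical complexity is the entropy of the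
stationary law after merging symbols with equal rows (`IsMarkovLaw.classicalComplexity_eq`).
Forwards the symbols `0` and `2` have equal rows; backwards the three rows are distinct when
`0 < p, q < 1`, and splitting an atom strictly increases entropy (`eta_add_lt`).

*Existence.* A stationary Markov chain on the integers is obtained by running the chain from time
zero in both directions of time, which is possible because the perturbed coin is reversible
(`exists_isMarkovLaw`); the heralding coin is a function of it.
-/

/-! ### The entropy functions -/

lemma eta_eq (x : ℝ) : eta x = Real.negMulLog x / Real.log 2 := by
  simp only [eta, Real.negMulLog, Real.logb]; ring

lemma continuous_eta : Continuous eta := by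
  have : eta = fun x => Real.negMulLog x / Real.log 2 := funext eta_eq
  rw [this]
  exact Real.continuous_negMulLog.div_const _

lemma eta_nonneg {x : ℝ} (h0 : 0 ≤ x) (h1 : x ≤ 1) : 0 ≤ eta x := by
  rw [eta_eq]
  exact div_nonneg (Real.negMulLog_nonneg h0 h1) (Real.log_nonneg one_le_two)

lemma eta_zero : eta 0 = 0 := by simp [eta]

lemma eta_one : eta 1 = 0 := by simp [eta]

lemma binEnt_eq (x : ℝ) : binEnt x = Real.binEntropy x / Real.log 2 := by
  rw [binEnt, eta_eq, eta_eq, Real.binEntropy_eq_negMulLog_add_negMulLog_one_sub, add_div]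

lemma binEnt_nonneg {x : ℝ} (h0 : 0 ≤ x) (h1 : x ≤ 1) : 0 ≤ binEnt x :=
  add_nonneg (eta_nonneg h0 h1) (eta_nonneg (by linarith) (by linarith))

lemma binEnt_one_sub (x : ℝ) : binEnt (1 - x) = binEnt x := by
  simp [binEnt, add_comm]

lemma binEnt_le_one (x : ℝ) : binEnt x ≤ 1 := by
  rw [binEnt_eq, div_le_one (Real.log_pos one_lt_two)]
  exact Real.binEntropy_le_log_two

lemma binEnt_anti {x y : ℝ} (hx : 1 / 2 ≤ x) (hxy : x ≤ y) (hy : y ≤ 1) :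
    binEnt y ≤ binEnt x := by
  rw [binEnt_eq, binEnt_eq]
  refine div_le_div_of_nonneg_right ?_ (Real.log_nonneg one_le_two)
  exact Real.binEntropy_strictAntiOn.antitoneOn ⟨by linarith, by linarith⟩
    ⟨by linarith, by linarith⟩ hxy

lemma mul_neg_logb_le_eta {x m : ℝ} (h0 : 0 ≤ x) (hm : x ≤ m) :
    x * -Real.logb 2 m ≤ eta x := by
  rcases h0.eq_or_lt with rfl | h
  · simp [eta]
  · have := Real.logb_le_logb_of_le one_lt_two h hm
    rw [eta, mul_neg]
    exact neg_le_neg (mul_le_mul_of_nonneg_left this h0)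

lemma self_le_eta {x : ℝ} (h0 : 0 ≤ x) (h1 : x ≤ 1 / 2) : x ≤ eta x := by
  have h := mul_neg_logb_le_eta h0 h1
  have : Real.logb 2 (1 / 2) = -1 := by
    rw [one_div, Real.logb_inv, Real.logb_self_eq_one one_lt_two]
  rwa [this, neg_neg, mul_one] at h

/-- Splitting an outcome of positive probability into two increases the Shannon entropy. -/
lemma eta_add_lt {a b : ℝ} (ha : 0 < a) (hb : 0 < b) : eta (a + b) < eta a + eta b := by
  have h1 := Real.logb_lt_logb one_lt_two ha (by linarith : a < a + b)
  have h2 := Real.logb_lt_logb one_lt_two hb (by linarith : b < a + b)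
  simp only [eta]
  nlinarith [mul_lt_mul_of_pos_left h1 ha, mul_lt_mul_of_pos_left h2 hb]

/-- A probability distribution none of whose weights exceeds `L` has entropy at least `h(L)`. If
`L ≥ 1/2` this is majorisation by `(L, 1 - L)`; if all weights are at most `1/2`, the entropy is
at least one bit. -/
lemma binEnt_le_tsum_eta {ι : Type*} {l : ι → ℝ} {L : ℝ} (h0 : ∀ j, 0 ≤ l j)
    (hL : ∀ j, l j ≤ L) (hs : HasSum l 1) (h1 : L ≤ 1) :
    ENNReal.ofReal (binEnt L) ≤ ∑' j, ENNReal.ofReal (eta (l j)) := by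
  classical
  by_cases hc : ∀ j, l j ≤ 1 / 2
  · calc ENNReal.ofReal (binEnt L) ≤ ENNReal.ofReal 1 := ENNReal.ofReal_le_ofReal (binEnt_le_one L)
      _ = ∑' j, ENNReal.ofReal (l j) := by
        rw [← hs.tsum_eq, ENNReal.ofReal_tsum_of_nonneg h0 hs.summable]
      _ ≤ _ := ENNReal.tsum_le_tsum fun j => ENNReal.ofReal_le_ofReal (self_le_eta (h0 j) (hc j))
  · push Not at hc
    obtain ⟨j₀, hj₀⟩ := hc
    set μ := l j₀ with hμ
    have hμ1 : μ ≤ 1 := (hL j₀).trans h1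
    -- all the other weights fit into the remaining probability `1 - μ < 1/2`
    have hrest : ∀ j, j ≠ j₀ → l j ≤ 1 - μ := by
      intro j hj
      have := sum_le_hasSum {j, j₀} (fun i _ => h0 i) hs
      rw [Finset.sum_pair hj] at this
      linarith
    set c : ℝ := -Real.logb 2 (1 - μ) with hc
    have hc0 : 0 ≤ c := neg_nonneg.2 (Real.logb_nonpos one_lt_two (by linarith) (by linarith))
    have hg := (hs.mul_right c).update j₀ (eta μ)
    have hgnn : ∀ j, 0 ≤ Function.update (fun i => l i * c) j₀ (eta μ) j := by
      intro j
      rcases eq_or_ne j j₀ with rfl | hj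
      · simpa using eta_nonneg (h0 _) hμ1
      · simpa [hj] using mul_nonneg (h0 j) hc0
    have hval : eta μ - l j₀ * c + 1 * c = binEnt μ := by
      rw [binEnt, eta, eta, hc, ← hμ]; ring
    calc ENNReal.ofReal (binEnt L) ≤ ENNReal.ofReal (binEnt μ) :=
          ENNReal.ofReal_le_ofReal (binEnt_anti hj₀.le (hL j₀) h1)
      _ = ∑' j, ENNReal.ofReal (Function.update (fun i => l i * c) j₀ (eta μ) j) := by
        rw [← hval, ← hg.tsum_eq, ENNReal.ofReal_tsum_of_nonneg hgnn hg.summable]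
      _ ≤ _ := by
        refine ENNReal.tsum_le_tsum fun j => ENNReal.ofReal_le_ofReal ?_
        rcases eq_or_ne j j₀ with rfl | hj
        · simp [hμ]
        · rw [Function.update_of_ne hj]
          exact mul_neg_logb_le_eta (h0 j) (hrest j hj)

/-- A distribution with at most two outcomes is determined, up to order, by the sum of its
squared weights. -/
lemma tsum_eta_eq_binEnt {ι : Type*} {l : ι → ℝ} {D : ℝ} {s : Finset ι} (hcard : s.card ≤ 2)
    (hs0 : ∀ j ∉ s, l j = 0) (h0 : ∀ j, 0 ≤ l j) (hs : HasSum l 1)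
    (hsq : HasSum (fun j => l j ^ 2) (1 - 2 * D)) :
    ∑' j, ENNReal.ofReal (eta (l j)) = ENNReal.ofReal (binEnt ((1 + √(1 - 4 * D)) / 2)) := by
  classical
  have e1 : ∑ j ∈ s, l j = 1 := (hasSum_sum_of_ne_finset_zero hs0).unique hs
  have e2 : ∑ j ∈ s, l j ^ 2 = 1 - 2 * D :=
    (hasSum_sum_of_ne_finset_zero fun j hj => by simp [hs0 j hj]).unique hsq
  rw [tsum_eq_sum (s := s) fun j hj => by simp [hs0 j hj, eta_zero]]
  have key : ∀ x : ℝ, x ^ 2 + (1 - x) ^ 2 = 1 - 2 * D →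
      binEnt ((1 + √(1 - 4 * D)) / 2) = binEnt x := by
    intro x hx
    have : 1 - 4 * D = (2 * x - 1) ^ 2 := by linarith
    rw [this, Real.sqrt_sq_eq_abs]
    rcases abs_cases (2 * x - 1) with ⟨h, _⟩ | ⟨h, _⟩ <;> rw [h]
    · congr 1; ring
    · rw [← binEnt_one_sub x]; congr 1; ring
  interval_cases hc : s.card
  · rw [Finset.card_eq_zero.1 hc] at e1; simp at e1
  · obtain ⟨j, rfl⟩ := Finset.card_eq_one.1 hc
    simp only [Finset.sum_singleton] at *
    rw [key 1 (by rw [← e2, e1]; ring), e1]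
    simp [binEnt, eta_one, eta_zero]
  · obtain ⟨j, k, hjk, rfl⟩ := Finset.card_eq_two.1 hc
    simp only [Finset.sum_pair hjk] at *
    have hk : l k = 1 - l j := by linarith
    have h0j := h0 j
    have h0k := h0 k
    rw [key (l j) (by rw [← e2, hk]), ← ENNReal.ofReal_add (eta_nonneg h0j (by linarith))
      (eta_nonneg h0k (by linarith)), hk, binEnt]

/-! ### Spectral decomposition and the von Neumann entropy -/

lemma HilbertBasis.hasSum_norm_inner_sq {H : Type*} [NormedAddCommGroup H]
    [InnerProductSpace ℂ H] {ι : Type*} (b : HilbertBasis ι ℂ H) (v : H) :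
    HasSum (fun i => ‖⟪b i, v⟫_ℂ‖ ^ 2) (‖v‖ ^ 2) := by
  have h := (b.hasSum_inner_mul_inner v v).mapL Complex.reCLM
  have e : ∀ i, Complex.re (⟪v, b i⟫_ℂ * ⟪b i, v⟫_ℂ) = ‖⟪b i, v⟫_ℂ‖ ^ 2 := by
    intro i
    rw [← inner_conj_symm v (b i), mul_comm, Complex.mul_conj, Complex.ofReal_re,
      Complex.normSq_eq_norm_sq]
  simp only [Complex.reCLM_apply, e] at h
  convert h using 1
  rw [inner_self_eq_norm_sq_to_K]
  norm_cast

section Spectral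

variable {H : Type} [NormedAddCommGroup H] [InnerProductSpace ℂ H] [CompleteSpace H]

lemma exists_hilbertBasis_eigenvectors {T : H →L[ℂ] H} (hc : IsCompactOperator T)
    (hs : IsSelfAdjoint T) :
    ∃ (ι : Type) (b : HilbertBasis ι ℂ H) (l : ι → ℝ), ∀ j, T (b j) = (l j : ℂ) • b j := by
  have hsym : (T : H →ₗ[ℂ] H).IsSymmetric := hs.isSymmetric
  have hfam := hsym.orthogonalFamily_eigenspaces
  choose w e he using fun μ : ℂ =>
    exists_hilbertBasis ℂ (Module.End.eigenspace (T : H →ₗ[ℂ] H) μ)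
  have hon := hfam.orthonormal_sigma_orthonormal fun μ => (e μ).orthonormal
  refine ⟨Σ μ : ℂ, w μ, HilbertBasis.mkOfOrthogonalEqBot hon ?_, fun j => j.1.re, ?_⟩
  · rw [eq_bot_iff,
      ← ContinuousLinearMap.orthogonalComplement_iSup_eigenspaces_eq_bot hc hsym]
    intro x hx
    rw [Submodule.mem_orthogonal] at hx ⊢
    have hle : (⨆ μ, Module.End.eigenspace (T : H →ₗ[ℂ] H) μ) ≤ (ℂ ∙ x)ᗮ := by
      refine iSup_le fun μ v hv => ?_
      rw [Submodule.mem_orthogonal_singleton_iff_inner_left]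
      have h1 := (e μ).hasSum_inner_mul_inner
        ⟨v, hv⟩ ((Module.End.eigenspace (T : H →ₗ[ℂ] H) μ).orthogonalProjectionOnto x)
      have h2 : ∀ i, ⟪e μ i, (Module.End.eigenspace (T : H →ₗ[ℂ] H) μ).orthogonalProjectionOnto x⟫_ℂ
          = 0 := by
        intro i
        rw [Submodule.inner_orthogonalProjectionOnto_eq_of_mem_left]
        exact hx _ (Submodule.subset_span ⟨⟨μ, i⟩, rfl⟩)
      simp only [h2, mul_zero] at h1
      have h3 := h1.unique hasSum_zero
      rwa [Submodule.inner_orthogonalProjectionOnto_eq_of_mem_left] at h3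
    intro u hu
    exact (Submodule.mem_orthogonal_singleton_iff_inner_left).1 (hle hu)
  · rintro ⟨μ, i⟩
    simp only [HilbertBasis.coe_mkOfOrthogonalEqBot]
    have hmem : T (e μ i : H) = μ • (e μ i : H) := Module.End.mem_eigenspace_iff.1 (e μ i).2
    have hne : (e μ i : H) ≠ 0 := by
      simpa using (e μ).orthonormal.ne_zero i
    have hev : Module.End.HasEigenvalue (T : H →ₗ[ℂ] H) μ :=
      Module.End.hasEigenvalue_of_hasEigenvector ⟨(e μ i).2, hne⟩
    have hre : ((μ.re : ℝ) : ℂ) = μ := Complex.conj_eq_iff_re.1 (hsym.conj_eigenvalue_eq_self hev)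
    simpa [hre] using hmem

lemma cfc_apply_of_apply_eq_smul {T : H →L[ℂ] H} (hs : IsSelfAdjoint T) {v : H} (hv : v ≠ 0)
    {r : ℝ} (hr : T v = (r : ℂ) • v) {f : ℝ → ℝ} (hf : Continuous f) :
    cfc f T v = (f r : ℂ) • v := by
  have hmem : r ∈ spectrum ℝ T := by
    rw [spectrum.mem_iff]
    rintro ⟨u, hu⟩
    have h0 : (u : H →L[ℂ] H) v = 0 := by
      rw [hu]
      simp [Algebra.algebraMap_eq_smul_one, hr]
    have h1 : ((u⁻¹ : (H →L[ℂ] H)ˣ) : H →L[ℂ] H) ((u : H →L[ℂ] H) v) = v := by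
      rw [← mul_apply_eq_comp, Units.inv_mul]; rfl
    rw [h0, map_zero] at h1
    exact hv h1.symm
  have key : ∀ g : C(spectrum ℝ T, ℝ), cfcHom hs g v = ((g ⟨r, hmem⟩ : ℝ) : ℂ) • v := by
    intro g
    induction g using ContinuousMap.induction_on_of_compact with
    | const c =>
      have : (ContinuousMap.const (spectrum ℝ T) c) = algebraMap ℝ C(spectrum ℝ T, ℝ) c := rfl
      rw [this, AlgHomClass.commutes]
      simp [Algebra.algebraMap_eq_smul_one]
    | id => rw [cfcHom_id]; simpa using hr
    | star_id => rw [star_trivial, cfcHom_id]; simpa using hr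
    | add f g hf hg => simp [map_add, hf, hg, add_smul]
    | mul f g hf hg =>
      rw [map_mul, mul_apply_eq_comp, hg, map_smul, hf, smul_smul, ContinuousMap.mul_apply,
        Complex.ofReal_mul, mul_comm]
    | frequently f hf =>
      have hcl : IsClosed {g : C(spectrum ℝ T, ℝ) |
          cfcHom hs g v = ((g ⟨r, hmem⟩ : ℝ) : ℂ) • v} := by
        refine isClosed_eq ?_ ?_
        · exact (ContinuousLinearMap.apply ℂ H v).continuous.comp (cfcHom_continuous hs)
        · exact (Complex.continuous_ofReal.comp
            (continuous_eval_const (⟨r, hmem⟩ : spectrum ℝ T))).smul continuous_const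
      exact hcl.closure_subset (mem_closure_iff_frequently.2 hf)
  rw [cfc_apply f T hs hf.continuousOn]
  exact key _

/-- The entropy of a density operator is the Shannon entropy of its eigenvalues. -/
lemma vonNeumannEntropy_eq_tsum {T : H →L[ℂ] H} (hs : IsSelfAdjoint T) {ι : Type}
    (b : HilbertBasis ι ℂ H) {l : ι → ℝ} (hb : ∀ j, T (b j) = (l j : ℂ) • b j)
    (h0 : ∀ j, 0 ≤ l j) (h1 : ∀ j, l j ≤ 1) :
    vonNeumannEntropy T = ∑' j, ENNReal.ofReal (eta (l j)) := by
  rw [vonNeumannEntropy]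
  set e := (exists_hilbertBasis ℂ H).choose_spec.choose
  set S := cfc eta T with hS
  have hSb : ∀ j, S (b j) = (eta (l j) : ℂ) • b j := fun j =>
    cfc_apply_of_apply_eq_smul hs (b.orthonormal.ne_zero j) (hb j) continuous_eta
  have hSsa : IsSelfAdjoint S := cfc_predicate eta T
  have hη : ∀ j, 0 ≤ eta (l j) := fun j => eta_nonneg (h0 j) (h1 j)
  have hdiag : ∀ v, ENNReal.ofReal (RCLike.re ⟪v, S v⟫_ℂ) =
      ∑' j, ENNReal.ofReal (eta (l j)) * ENNReal.ofReal (‖⟪b j, v⟫_ℂ‖ ^ 2) := by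
    intro v
    have h := (b.hasSum_inner_mul_inner v (S v)).mapL Complex.reCLM
    have e : ∀ i, Complex.re (⟪v, b i⟫_ℂ * ⟪b i, S v⟫_ℂ) = eta (l i) * ‖⟪b i, v⟫_ℂ‖ ^ 2 := by
      intro i
      have hsym : ⟪b i, S v⟫_ℂ = ⟪S (b i), v⟫_ℂ := (hSsa.isSymmetric (b i) v).symm
      rw [hsym, hSb, inner_smul_left, ← inner_conj_symm v (b i), mul_comm, mul_assoc,
        Complex.mul_conj, Complex.conj_ofReal, ← Complex.ofReal_mul, Complex.ofReal_re,
        Complex.normSq_eq_norm_sq]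
    simp only [Complex.reCLM_apply, e] at h
    change ENNReal.ofReal (Complex.re _) = _
    rw [← h.tsum_eq, ENNReal.ofReal_tsum_of_nonneg
      (fun j => mul_nonneg (hη j) (sq_nonneg _)) h.summable]
    exact tsum_congr fun j => ENNReal.ofReal_mul (hη j)
  simp only [hdiag]
  rw [ENNReal.tsum_comm]
  refine tsum_congr fun j => ?_
  rw [ENNReal.tsum_mul_left]
  have h := e.hasSum_norm_inner_sq (b j)
  have hn : ∀ i, ‖⟪b j, e i⟫_ℂ‖ ^ 2 = ‖⟪e i, b j⟫_ℂ‖ ^ 2 := fun i => by rw [norm_inner_symm]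
  simp only [hn]
  rw [← ENNReal.ofReal_tsum_of_nonneg (fun _ => sq_nonneg _) h.summable, h.tsum_eq]
  simp [b.orthonormal.1 j]

end Spectral

/-! ### Averages of pure states -/

lemma ketBra_apply {H : Type} [NormedAddCommGroup H] [InnerProductSpace ℂ H] (φ ψ x : H) :
    ketBra φ ψ x = ⟪ψ, x⟫_ℂ • φ := rfl

lemma norm_ketBra {H : Type} [NormedAddCommGroup H] [InnerProductSpace ℂ H] (φ ψ : H) :
    ‖ketBra φ ψ‖ = ‖φ‖ * ‖ψ‖ := InnerProductSpace.norm_rankOne φ ψ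

lemma inner_ketBra_self {H : Type} [NormedAddCommGroup H] [InnerProductSpace ℂ H] (φ ψ : H) :
    ⟪ψ, ketBra φ φ ψ⟫_ℂ = ((‖⟪ψ, φ⟫_ℂ‖ ^ 2 : ℝ) : ℂ) := by
  rw [ketBra_apply, inner_smul_right, ← inner_conj_symm φ ψ, mul_comm, Complex.mul_conj,
    Complex.normSq_eq_norm_sq]

section Ensemble

variable {H : Type} [NormedAddCommGroup H] [InnerProductSpace ℂ H]
  {Y : Type} [MeasurableSpace Y] {μ : Measure Y} {f : Y → H}

lemma integrable_ketBra [IsFiniteMeasure μ] (hf : ∀ y, ‖f y‖ = 1)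
    (hm : AEStronglyMeasurable (fun y => ketBra (f y) (f y)) μ) :
    Integrable (fun y => ketBra (f y) (f y)) μ :=
  Integrable.of_bound hm 1 (.of_forall fun y => by simp [norm_ketBra, hf])

lemma integrable_norm_inner_sq [IsFiniteMeasure μ] (hf : ∀ y, ‖f y‖ = 1)
    (hm : AEStronglyMeasurable (fun y => ketBra (f y) (f y)) μ) (ψ : H) :
    Integrable (fun y => ‖⟪ψ, f y⟫_ℂ‖ ^ 2) μ := by
  have h1 := (integrable_ketBra hf hm).apply_continuousLinearMap ψ
  have h2 := ((innerSL ℂ ψ).integrable_comp h1).re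
  refine h2.congr (.of_forall fun y => ?_)
  change RCLike.re ⟪ψ, ketBra (f y) (f y) ψ⟫_ℂ = _
  rw [inner_ketBra_self]
  exact Complex.ofReal_re _

lemma integral_ketBra_apply [IsFiniteMeasure μ] (hf : ∀ y, ‖f y‖ = 1)
    (hm : AEStronglyMeasurable (fun y => ketBra (f y) (f y)) μ) (ψ : H) :
    (∫ y, ketBra (f y) (f y) ∂μ) ψ = ∫ y, ⟪f y, ψ⟫_ℂ • f y ∂μ :=
  ContinuousLinearMap.integral_apply (integrable_ketBra hf hm) ψ

variable [CompleteSpace H]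

lemma inner_integral_ketBra_self [IsFiniteMeasure μ] (hf : ∀ y, ‖f y‖ = 1)
    (hm : AEStronglyMeasurable (fun y => ketBra (f y) (f y)) μ) (ψ : H) :
    ⟪ψ, (∫ y, ketBra (f y) (f y) ∂μ) ψ⟫_ℂ = ((∫ y, ‖⟪ψ, f y⟫_ℂ‖ ^ 2 ∂μ : ℝ) : ℂ) := by
  have h1 := (integrable_ketBra hf hm).apply_continuousLinearMap ψ
  rw [ContinuousLinearMap.integral_apply (integrable_ketBra hf hm), ← integral_inner h1,
    ← integral_complex_ofReal]
  exact integral_congr_ae (.of_forall fun y => inner_ketBra_self _ _)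

lemma isSelfAdjoint_ketBra (φ : H) : IsSelfAdjoint (ketBra φ φ) := by
  rw [ContinuousLinearMap.isSelfAdjoint_iff_isSymmetric]
  intro x y
  change ⟪ketBra φ φ x, y⟫_ℂ = ⟪x, ketBra φ φ y⟫_ℂ
  rw [ketBra_apply, ketBra_apply, inner_smul_left, inner_smul_right, inner_conj_symm, mul_comm]

lemma isSelfAdjoint_integral_ketBra [IsProbabilityMeasure μ] (hf : ∀ y, ‖f y‖ = 1)
    (hm : AEStronglyMeasurable (fun y => ketBra (f y) (f y)) μ) :
    IsSelfAdjoint (∫ y, ketBra (f y) (f y) ∂μ) := by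
  refine Convex.integral_mem (s := {T : H →L[ℂ] H | IsSelfAdjoint T}) ?_ ?_
    (.of_forall fun y => isSelfAdjoint_ketBra (f y)) (integrable_ketBra hf hm)
  · exact (selfAdjoint.submodule ℝ (H →L[ℂ] H)).convex
  · exact isClosed_eq continuous_star continuous_id

lemma isCompactOperator_integral_ketBra [IsProbabilityMeasure μ] (hf : ∀ y, ‖f y‖ = 1)
    (hm : AEStronglyMeasurable (fun y => ketBra (f y) (f y)) μ) :
    IsCompactOperator (∫ y, ketBra (f y) (f y) ∂μ : H →L[ℂ] H) := by
  refine Convex.integral_mem (s := {T : H →L[ℂ] H | IsCompactOperator T}) ?_ ?_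
    (.of_forall fun y => ?_) (integrable_ketBra hf hm)
  · intro S hS T hT a b _ _ _
    exact (hS.smul (a : ℂ)).add (hT.smul (b : ℂ))
  · exact isClosed_setOfPred_isCompactOperator
  · exact IsCompactOperator.clm_comp (isCompactOperator_of_locallyCompactSpace_dom
      (innerSL ℂ (f y))) (ContinuousLinearMap.toSpanSingleton ℂ (f y))

/-- Almost every state of an ensemble is orthogonal to the kernel of the average state. The
kernel may be non-separable, but the ensemble is essentially separable, so that countably many
conditions suffice. -/
lemma ae_inner_eq_zero_of_mem_ker [IsProbabilityMeasure μ] (hf : ∀ y, ‖f y‖ = 1)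
    (hm : AEStronglyMeasurable (fun y => ketBra (f y) (f y)) μ) :
    ∀ᵐ y ∂μ, ∀ v : H, (∫ y, ketBra (f y) (f y) ∂μ) v = 0 → ⟪v, f y⟫_ℂ = 0 := by
  set ρ := ∫ y, ketBra (f y) (f y) ∂μ with hρ
  have hpt : ∀ v : H, ρ v = 0 → ∀ᵐ y ∂μ, ⟪v, f y⟫_ℂ = 0 := by
    intro v hv
    have h := inner_integral_ketBra_self hf hm v
    rw [← hρ, hv, inner_zero_right, eq_comm, Complex.ofReal_eq_zero,
      integral_eq_zero_iff_of_nonneg (fun _ => sq_nonneg _) (integrable_norm_inner_sq hf hm v)] at h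
    filter_upwards [h] with y hy
    simpa using hy
  set K : Submodule ℂ H := LinearMap.ker (ρ : H →ₗ[ℂ] H) with hK
  have hKcl : IsClosed (K : Set H) := ρ.isClosed_ker
  have : CompleteSpace K := hKcl.completeSpace_coe
  obtain ⟨t, ht, hty⟩ := hm.isSeparable_ae_range
  obtain ⟨c, hct, hcc, hcd⟩ := (ht.mono (Set.inter_subset_left
    (t := Set.range fun y => ketBra (f y) (f y)))).exists_countable_dense_subset
  have hall : ∀ᵐ y ∂μ, ∀ T ∈ c, ⟪f y, K.starProjection (T (K.starProjection (f y)))⟫_ℂ = 0 := by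
    rw [ae_ball_iff hcc]
    intro T hT
    obtain ⟨y₀, rfl⟩ := (hct hT).2
    filter_upwards [hpt (K.starProjection (f y₀)) (K.starProjection_apply_mem (f y₀))] with y hy
    rw [ketBra_apply, map_smul, inner_smul_right, ← inner_conj_symm (f y), hy]
    simp
  filter_upwards [hall, hty] with y hy hyt v hv
  have hcl : IsClosed {T : H →L[ℂ] H |
      ⟪f y, K.starProjection (T (K.starProjection (f y)))⟫_ℂ = 0} := by
    refine isClosed_eq ?_ continuous_const
    fun_prop
  have h0 : ⟪f y, K.starProjection (ketBra (f y) (f y) (K.starProjection (f y)))⟫_ℂ = 0 :=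
    closure_minimal hy hcl (hcd ⟨hyt, ⟨y, rfl⟩⟩)
  have h1 : ⟪f y, K.starProjection (f y)⟫_ℂ = 0 := by
    rw [ketBra_apply, map_smul, inner_smul_right] at h0
    exact mul_self_eq_zero.1 h0
  have h2 : K.starProjection (f y) = 0 := by
    rw [← inner_self_eq_zero (𝕜 := ℂ), K.inner_starProjection_left_eq_right,
      K.starProjection_eq_self_iff.2 (K.starProjection_apply_mem _)]
    exact h1
  rw [← K.starProjection_eq_self_iff.2 (show v ∈ K from hv),
    K.inner_starProjection_left_eq_right, h2, inner_zero_right]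

lemma eigenvalue_integral_ketBra [IsFiniteMeasure μ] (hf : ∀ y, ‖f y‖ = 1)
    (hm : AEStronglyMeasurable (fun y => ketBra (f y) (f y)) μ) {ι : Type}
    (b : HilbertBasis ι ℂ H) {l : ι → ℝ}
    (hb : ∀ j, (∫ y, ketBra (f y) (f y) ∂μ) (b j) = (l j : ℂ) • b j) (j : ι) :
    l j = ∫ y, ‖⟪b j, f y⟫_ℂ‖ ^ 2 ∂μ := by
  have h := inner_integral_ketBra_self hf hm (b j)
  rw [hb, inner_smul_right, inner_self_eq_norm_sq_to_K, b.orthonormal.1] at h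
  exact_mod_cast (by simpa using h)

/-- The eigenvalues of the average of an ensemble of pure states add up to one. -/
lemma hasSum_eigenvalues_integral_ketBra [IsProbabilityMeasure μ] (hf : ∀ y, ‖f y‖ = 1)
    (hm : AEStronglyMeasurable (fun y => ketBra (f y) (f y)) μ) {ι : Type}
    (b : HilbertBasis ι ℂ H) {l : ι → ℝ}
    (hb : ∀ j, (∫ y, ketBra (f y) (f y) ∂μ) (b j) = (l j : ℂ) • b j) : HasSum l 1 := by
  have hl := eigenvalue_integral_ketBra hf hm b hb
  have h0 : ∀ j, 0 ≤ l j := fun j => hl j ▸ integral_nonneg fun _ => sq_nonneg _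
  have hle : ∀ s : Finset ι, ∑ j ∈ s, l j ≤ 1 := by
    intro s
    simp only [hl]
    rw [← integral_finsetSum _ fun j _ => integrable_norm_inner_sq hf hm (b j)]
    calc _ ≤ ∫ _, (1 : ℝ) ∂μ := by
          refine integral_mono (integrable_finsetSum _ fun j _ =>
            integrable_norm_inner_sq hf hm (b j)) (integrable_const _) fun y => ?_
          simpa [hf] using b.orthonormal.sum_inner_products_le (f y) (s := s)
      _ = 1 := by simp
  have hsum : Summable l := summable_of_sum_le h0 hle
  have hcount : (Function.support l).Countable := hsum.countable_support
  have : Countable (Function.support l) := hcount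
  have hker := ae_inner_eq_zero_of_mem_ker hf hm
  have key : ∑' j : Function.support l, ENNReal.ofReal (l j) = 1 := by
    have e1 : ∀ j, ENNReal.ofReal (l j) = ∫⁻ y, ENNReal.ofReal (‖⟪b j, f y⟫_ℂ‖ ^ 2) ∂μ := by
      intro j
      rw [hl, ofReal_integral_eq_lintegral_ofReal (integrable_norm_inner_sq hf hm (b j))
        (.of_forall fun _ => sq_nonneg _)]
    simp only [e1]
    rw [← lintegral_tsum fun j : Function.support l =>
      (integrable_norm_inner_sq hf hm (b j)).aestronglyMeasurable.aemeasurable.ennreal_ofReal]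
    have e2 : ∀ᵐ y ∂μ, ∑' j : Function.support l, ENNReal.ofReal (‖⟪b j, f y⟫_ℂ‖ ^ 2) = 1 := by
      filter_upwards [hker] with y hy
      have h := b.hasSum_norm_inner_sq (f y)
      have hsub : Function.support (fun j => ENNReal.ofReal (‖⟪b j, f y⟫_ℂ‖ ^ 2))
          ⊆ Function.support l := by
        intro j hj hlj
        refine hj ?_
        have := hy (b j) (by rw [hb, hlj]; simp)
        simp [this]
      rw [tsum_subtype_eq_of_support_subset hsub,
        ← ENNReal.ofReal_tsum_of_nonneg (fun _ => sq_nonneg _) h.summable, h.tsum_eq, hf]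
      simp
    rw [lintegral_congr_ae e2]
    simp
  rw [tsum_subtype_eq_of_support_subset (f := fun j => ENNReal.ofReal (l j))
    (s := Function.support l) (fun j hj hlj => hj (by simp [show l j = 0 from hlj])),
    ← ENNReal.ofReal_tsum_of_nonneg h0 hsum, ENNReal.ofReal_eq_one] at key
  exact key ▸ hsum.hasSum

end Ensemble

/-! ### Bounds on the entropy of an ensemble -/

section EnsembleBounds

variable {H : Type} [NormedAddCommGroup H] [InnerProductSpace ℂ H]
  {Y : Type} [MeasurableSpace Y] {μ : Measure Y} {f : Y → H}
  {ι : Type} [Fintype ι] [MeasurableSpace ι] [MeasurableSingletonClass ι] {c : Y → ι}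

lemma integral_eq_sum_fiber (hc : Measurable c) {g : Y → ℝ} (hg : Integrable g μ) :
    ∫ y, g y ∂μ = ∑ i, ∫ y in c ⁻¹' {i}, g y ∂μ := by
  rw [← integral_iUnion_fintype (fun i => hc (measurableSet_singleton i))
    (fun i j hij => Set.disjoint_left.2 fun y hi hj => hij (hi.symm.trans hj))
    fun i => hg.integrableOn]
  have : (⋃ i, c ⁻¹' {i}) = Set.univ := by ext; simp
  rw [this, setIntegral_univ]

/-- If the overlap between states of an ensemble is, class by class, at most the overlap of real
vectors `s i`, then the largest eigenvalue of the average state is at most that of the mixture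
of the `s i`. In terms of Gram matrices, this is the monotonicity of the largest eigenvalue in
the absolute values of the entries. -/
lemma integral_norm_inner_sq_le [IsProbabilityMeasure μ] (hf : ∀ y, ‖f y‖ = 1)
    (hm : AEStronglyMeasurable (fun y => ketBra (f y) (f y)) μ) (hc : Measurable c)
    {E : Type} [NormedAddCommGroup E] [InnerProductSpace ℝ E] {s : ι → E} {p : Y → Prop}
    (hp : ∀ᵐ y ∂μ, p y)
    (hs : ∀ y y', p y → p y' → ‖⟪f y, f y'⟫_ℂ‖ ≤ ⟪s (c y), s (c y')⟫_ℝ) {L : ℝ}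
    (hL0 : 0 ≤ L) (hL : ∀ w : E, ∑ i, μ.real (c ⁻¹' {i}) * ⟪s i, w⟫_ℝ ^ 2 ≤ L * ‖w‖ ^ 2) (ψ : H) :
    ∫ y, ‖⟪ψ, f y⟫_ℂ‖ ^ 2 ∂μ ≤ L * ‖ψ‖ ^ 2 := by
  set π : ι → ℝ := fun i => μ.real (c ⁻¹' {i}) with hπ
  have hπ0 : ∀ i, 0 ≤ π i := fun i => measureReal_nonneg
  have hint := integrable_norm_inner_sq hf hm ψ
  obtain ⟨y₀, -⟩ := hp.exists
  -- a representative of each class whose overlap with `ψ` is at least the average over the class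
  have hrep : ∀ i, ∃ y, π i ≠ 0 → p y ∧ c y = i ∧
      ∫ y in c ⁻¹' {i}, ‖⟪ψ, f y⟫_ℂ‖ ^ 2 ∂μ ≤ π i * ‖⟪ψ, f y⟫_ℂ‖ ^ 2 := by
    intro i
    by_cases hi : π i = 0
    · exact ⟨y₀, fun h => absurd hi h⟩
    have hne : μ.restrict (c ⁻¹' {i}) ≠ 0 := by
      intro h
      rw [Measure.restrict_eq_zero] at h
      exact hi (by simp [hπ, measureReal_def, h])
    have hN : ∀ᵐ y ∂μ.restrict (c ⁻¹' {i}), p y ∧ c y = i :=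
      (ae_restrict_of_ae hp).and (ae_restrict_mem (hc (measurableSet_singleton i)))
    obtain ⟨y, hyN, hy⟩ := exists_notMem_null_average_le (N := {y | ¬(p y ∧ c y = i)}) hne
      (hint.integrableOn (s := c ⁻¹' {i})) hN
    rw [Set.mem_ofPred_eq, not_not] at hyN
    refine ⟨y, fun _ => ⟨hyN.1, hyN.2, ?_⟩⟩
    rw [average_eq, smul_eq_mul, measureReal_restrict_apply_univ] at hy
    have hpos : 0 < π i := (hπ0 i).lt_of_ne' hi
    exact (inv_mul_le_iff₀ hpos).1 hy
  choose y hy using hrep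
  set a : ι → ℂ := fun i => ⟪f (y i), ψ⟫_ℂ with ha
  have hna : ∀ i, ‖⟪ψ, f (y i)⟫_ℂ‖ = ‖a i‖ := fun i => norm_inner_symm _ _
  set t : ℝ := ∑ i, π i * ‖a i‖ ^ 2 with ht
  have ht0 : 0 ≤ t := Finset.sum_nonneg fun i _ => mul_nonneg (hπ0 i) (sq_nonneg _)
  have hle : ∫ y, ‖⟪ψ, f y⟫_ℂ‖ ^ 2 ∂μ ≤ t := by
    rw [integral_eq_sum_fiber hc hint]
    refine Finset.sum_le_sum fun i _ => ?_
    by_cases hi : π i = 0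
    · have : μ.restrict (c ⁻¹' {i}) = 0 := by
        rw [Measure.restrict_eq_zero]
        exact (measureReal_eq_zero_iff).1 hi
      simp [this, hi]
    · rw [← hna]; exact (hy i hi).2.2
  refine hle.trans ?_
  set u : H := ∑ i, ((π i : ℂ) * a i) • f (y i) with hu
  set w : E := ∑ i, (π i * ‖a i‖) • s i with hw
  have hψu : ⟪u, ψ⟫_ℂ = (t : ℂ) := by
    rw [hu, sum_inner, ht, Complex.ofReal_sum]
    refine Finset.sum_congr rfl fun i _ => ?_
    rw [inner_smul_left, map_mul, Complex.conj_ofReal, mul_assoc, mul_comm ((starRingEnd ℂ) (a i)),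
      ← Complex.normSq_eq_norm_sq, Complex.ofReal_mul, ← Complex.mul_conj]
  have huw : ‖u‖ ^ 2 ≤ ‖w‖ ^ 2 := by
    have h1 : ((‖u‖ ^ 2 : ℝ) : ℂ) =
        ∑ i, ∑ j, (starRingEnd ℂ) (π i * a i) * ((π j * a j) * ⟪f (y i), f (y j)⟫_ℂ) := by
      have : ((‖u‖ ^ 2 : ℝ) : ℂ) = ⟪u, u⟫_ℂ := by
        rw [inner_self_eq_norm_sq_to_K]; norm_cast
      rw [this, hu, sum_inner]
      refine Finset.sum_congr rfl fun i _ => ?_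
      rw [inner_sum]
      exact Finset.sum_congr rfl fun j _ => by rw [inner_smul_left, inner_smul_right]
    have h2 : ‖w‖ ^ 2 = ∑ i, ∑ j, (π i * ‖a i‖) * ((π j * ‖a j‖) * ⟪s i, s j⟫_ℝ) := by
      rw [← real_inner_self_eq_norm_sq, hw, sum_inner]
      refine Finset.sum_congr rfl fun i _ => ?_
      rw [inner_sum]
      exact Finset.sum_congr rfl fun j _ => by rw [real_inner_smul_left, real_inner_smul_right]
    have h3 : ‖u‖ ^ 2 = ‖((‖u‖ ^ 2 : ℝ) : ℂ)‖ := by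
      rw [Complex.norm_real, Real.norm_of_nonneg (sq_nonneg _)]
    rw [h3, h1, h2]
    refine (norm_sum_le _ _).trans (Finset.sum_le_sum fun i _ =>
      (norm_sum_le _ _).trans (Finset.sum_le_sum fun j _ => ?_))
    simp only [norm_mul, RCLike.norm_conj, Complex.norm_real, Real.norm_of_nonneg (hπ0 _)]
    by_cases hi : π i = 0
    · simp [hi]
    by_cases hj : π j = 0
    · simp [hj]
    have := hs _ _ (hy i hi).1 (hy j hj).1
    rw [(hy i hi).2.1, (hy j hj).2.1] at this
    have := hπ0 i
    have := hπ0 j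
    gcongr
  have hwt : ‖w‖ ^ 2 * ‖w‖ ^ 2 ≤ t * L * ‖w‖ ^ 2 := by
    have h1 : ‖w‖ ^ 2 = ∑ i, (√(π i) * ‖a i‖) * (√(π i) * ⟪s i, w⟫_ℝ) := by
      rw [← real_inner_self_eq_norm_sq]
      nth_rw 1 [hw]
      rw [sum_inner]
      refine Finset.sum_congr rfl fun i _ => ?_
      rw [real_inner_smul_left]
      nth_rw 1 [← Real.mul_self_sqrt (hπ0 i)]
      ring
    have h2 := Finset.sum_mul_sq_le_sq_mul_sq Finset.univ
      (fun i => √(π i) * ‖a i‖) (fun i => √(π i) * ⟪s i, w⟫_ℝ)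
    simp only [← h1, mul_pow, Real.sq_sqrt (hπ0 _)] at h2
    calc ‖w‖ ^ 2 * ‖w‖ ^ 2 = (‖w‖ ^ 2) ^ 2 := by ring
      _ ≤ t * (L * ‖w‖ ^ 2) := h2.trans (mul_le_mul_of_nonneg_left (hL w) ht0)
      _ = _ := by ring
  have hut : ‖u‖ ^ 2 ≤ t * L := by
    refine huw.trans ?_
    rcases (sq_nonneg ‖w‖).eq_or_lt with h | h
    · rw [← h]
      exact mul_nonneg ht0 hL0
    · exact le_of_mul_le_mul_right hwt h
  have htt : t ^ 2 ≤ ‖ψ‖ ^ 2 * (t * L) := by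
    have h1 : t ≤ ‖u‖ * ‖ψ‖ := by
      have := norm_inner_le_norm (𝕜 := ℂ) u ψ
      rwa [hψu, Complex.norm_real, Real.norm_of_nonneg ht0] at this
    calc t ^ 2 ≤ (‖u‖ * ‖ψ‖) ^ 2 := by gcongr
      _ = ‖ψ‖ ^ 2 * ‖u‖ ^ 2 := by ring
      _ ≤ _ := by gcongr
  rcases ht0.eq_or_lt with h | h
  · rw [← h]
    positivity
  · nlinarith

variable [CompleteSpace H]

/-- Eigenvalues of a convex mixture do not exceed its largest Rayleigh quotient, so a bound on the
latter gives a lower bound on the entropy. -/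
lemma binEnt_le_vonNeumannEntropy [IsProbabilityMeasure μ] (hf : ∀ y, ‖f y‖ = 1)
    (hm : AEStronglyMeasurable (fun y => ketBra (f y) (f y)) μ) {L : ℝ} (hL1 : L ≤ 1)
    (hL : ∀ ψ : H, ∫ y, ‖⟪ψ, f y⟫_ℂ‖ ^ 2 ∂μ ≤ L * ‖ψ‖ ^ 2) :
    ENNReal.ofReal (binEnt L) ≤ vonNeumannEntropy (∫ y, ketBra (f y) (f y) ∂μ) := by
  have hsa := isSelfAdjoint_integral_ketBra hf hm
  obtain ⟨κ, b, l, hb⟩ := exists_hilbertBasis_eigenvectors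
    (isCompactOperator_integral_ketBra hf hm) hsa
  have hl := eigenvalue_integral_ketBra hf hm b hb
  have h0 : ∀ j, 0 ≤ l j := fun j => hl j ▸ integral_nonneg fun _ => sq_nonneg _
  have h1 : ∀ j, l j ≤ L := by
    intro j
    have := hL (b j)
    rwa [← hl, b.orthonormal.1, one_pow, mul_one] at this
  rw [vonNeumannEntropy_eq_tsum hsa b hb h0 fun j => (h1 j).trans hL1]
  exact binEnt_le_tsum_eta h0 h1 (hasSum_eigenvalues_integral_ketBra hf hm b hb) hL1

/-- The entropy of a finite ensemble whose states span a plane, in terms of the purity of its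
average state. -/
lemma vonNeumannEntropy_eq_binEnt [IsProbabilityMeasure μ] (hc : Measurable c) {S : ι → H}
    (hS : ∀ i, ‖S i‖ = 1) (hfS : ∀ y, f y = S (c y))
    (hm : AEStronglyMeasurable (fun y => ketBra (f y) (f y)) μ)
    {V : Submodule ℂ H} [FiniteDimensional ℂ V] (hV : Module.finrank ℂ V ≤ 2)
    (hSV : ∀ i, S i ∈ V) {D : ℝ}
    (hD : ∑ i, ∑ k, μ.real (c ⁻¹' {i}) * (μ.real (c ⁻¹' {k}) * ‖⟪S i, S k⟫_ℂ‖ ^ 2) = 1 - 2 * D) :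
    vonNeumannEntropy (∫ y, ketBra (f y) (f y) ∂μ) =
      ENNReal.ofReal (binEnt ((1 + √(1 - 4 * D)) / 2)) := by
  classical
  have hf : ∀ y, ‖f y‖ = 1 := fun y => by rw [hfS, hS]
  have hsa := isSelfAdjoint_integral_ketBra hf hm
  obtain ⟨κ, b, l, hb⟩ := exists_hilbertBasis_eigenvectors
    (isCompactOperator_integral_ketBra hf hm) hsa
  have hl := eigenvalue_integral_ketBra hf hm b hb
  have hsum := hasSum_eigenvalues_integral_ketBra hf hm b hb
  have h0 : ∀ j, 0 ≤ l j := fun j => hl j ▸ integral_nonneg fun _ => sq_nonneg _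
  have h1 : ∀ j, l j ≤ 1 := fun j => le_hasSum hsum j fun i _ => h0 i
  set ρ := ∫ y, ketBra (f y) (f y) ∂μ with hρ
  have hquad : ∀ ψ : H, ∫ y, ‖⟪ψ, f y⟫_ℂ‖ ^ 2 ∂μ =
      ∑ k, μ.real (c ⁻¹' {k}) * ‖⟪ψ, S k⟫_ℂ‖ ^ 2 := by
    intro ψ
    rw [integral_eq_sum_fiber hc (integrable_norm_inner_sq hf hm ψ)]
    refine Finset.sum_congr rfl fun k _ => ?_
    rw [setIntegral_congr_fun (g := fun _ => ‖⟪ψ, S k⟫_ℂ‖ ^ 2) (hc (measurableSet_singleton k))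
      fun y hy => by rw [hfS, show c y = k from hy], setIntegral_const, smul_eq_mul]
  have hmem : ∀ ψ, ρ ψ ∈ V := by
    intro ψ
    rw [hρ, integral_ketBra_apply hf hm]
    have hVcl : IsClosed (V : Set H) := V.closed_of_finiteDimensional
    refine Convex.integral_mem (V.restrictScalars ℝ).convex hVcl (.of_forall fun y => ?_) ?_
    · exact V.smul_mem _ (hfS y ▸ hSV _)
    · exact (integrable_ketBra hf hm).apply_continuousLinearMap ψ
  have hbV : ∀ j : Function.support l, b j ∈ V := by
    rintro ⟨j, hj⟩
    have h := V.smul_mem ((l j : ℂ)⁻¹) (hmem (b j))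
    rwa [hb, inv_smul_smul₀ (by exact_mod_cast hj)] at h
  have hli : LinearIndependent ℂ fun j : Function.support l => (⟨b j, hbV j⟩ : V) := by
    refine LinearIndependent.of_comp V.subtype ?_
    exact b.orthonormal.linearIndependent.comp _ Subtype.val_injective
  have : Finite (Function.support l) := hli.finite
  have := Fintype.ofFinite (Function.support l)
  have hcard : (Function.support l).toFinset.card ≤ 2 := by
    rw [Set.toFinset_card]
    exact hli.fintype_card_le_finrank.trans hV
  rw [vonNeumannEntropy_eq_tsum hsa b hb h0 h1]
  refine tsum_eta_eq_binEnt hcard (fun j hj => by simpa using hj) h0 hsum ?_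
  have hpur : ∀ i, HasSum (fun j => l j * ‖⟪b j, S i⟫_ℂ‖ ^ 2)
      (∑ k, μ.real (c ⁻¹' {k}) * ‖⟪S i, S k⟫_ℂ‖ ^ 2) := by
    intro i
    have h := (b.hasSum_inner_mul_inner (S i) (ρ (S i))).mapL Complex.reCLM
    have e : ∀ j, Complex.re (⟪S i, b j⟫_ℂ * ⟪b j, ρ (S i)⟫_ℂ) = l j * ‖⟪b j, S i⟫_ℂ‖ ^ 2 := by
      intro j
      have hsym : ⟪b j, ρ (S i)⟫_ℂ = ⟪ρ (b j), S i⟫_ℂ := (hsa.isSymmetric (b j) (S i)).symm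
      rw [hsym, hb, inner_smul_left, ← inner_conj_symm (S i) (b j), mul_comm, mul_assoc,
        Complex.mul_conj, Complex.conj_ofReal, ← Complex.ofReal_mul, Complex.ofReal_re,
        Complex.normSq_eq_norm_sq]
    simp only [Complex.reCLM_apply, e] at h
    rwa [inner_integral_ketBra_self hf hm, Complex.ofReal_re, hquad] at h
  have := hasSum_sum fun i (_ : i ∈ Finset.univ) => (hpur i).mul_left (μ.real (c ⁻¹' {i}))
  simp only [Finset.mul_sum] at this
  rw [hD] at this
  have e : (fun j => l j ^ 2) =
      fun j => ∑ i, μ.real (c ⁻¹' {i}) * (l j * ‖⟪b j, S i⟫_ℂ‖ ^ 2) := by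
    funext j
    calc l j ^ 2 = l j * ∑ i, μ.real (c ⁻¹' {i}) * ‖⟪b j, S i⟫_ℂ‖ ^ 2 := by
          rw [← hquad, ← hl, sq]
      _ = _ := by
          rw [Finset.mul_sum]
          exact Finset.sum_congr rfl fun i _ => by ring
  rw [e]
  exact this

end EnsembleBounds

/-! ### Overlaps of the memory states of a quantum model -/

section Overlap

variable {H : Type} [NormedAddCommGroup H] [InnerProductSpace ℂ H]

/-- If the positive operators `|v k⟩⟨v k|` add up to a multiple of a pure state, each `v k` is
proportional to it, so that the squared norms add up to the trace. -/
lemma hasSum_norm_sq_of_hasSum_ketBra {κ : Type*} {v : κ → H} {g : H} (hg : ‖g‖ = 1) {p : ℝ}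
    (h : HasSum (fun k => ketBra (v k) (v k)) ((p : ℂ) • ketBra g g)) :
    HasSum (fun k => ‖v k‖ ^ 2) p := by
  have hφ : ∀ φ : H, HasSum (fun k => ‖⟪φ, v k⟫_ℂ‖ ^ 2) (p * ‖⟪φ, g⟫_ℂ‖ ^ 2) := by
    intro φ
    have h1 := ((h.mapL (ContinuousLinearMap.apply ℂ H φ)).mapL (innerSL ℂ φ)).mapL Complex.reCLM
    have e : ∀ u : H, Complex.re ⟪φ, ketBra u u φ⟫_ℂ = ‖⟪φ, u⟫_ℂ‖ ^ 2 := fun u => by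
      rw [inner_ketBra_self, Complex.ofReal_re]
    simpa [e] using h1
  have hv : ∀ k, ‖⟪g, v k⟫_ℂ‖ ^ 2 = ‖v k‖ ^ 2 := by
    intro k
    set w := v k - ⟪g, v k⟫_ℂ • g with hw
    have hgg : ⟪g, g⟫_ℂ = 1 := by rw [inner_self_eq_norm_sq_to_K, hg]; simp
    have hgw : ⟪g, w⟫_ℂ = 0 := by rw [hw, inner_sub_right, inner_smul_right, hgg]; simp
    have hwg : ⟪w, g⟫_ℂ = 0 := inner_eq_zero_symm.1 hgw
    have h1 := hφ w
    rw [hwg] at h1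
    have h2 := (hasSum_zero_iff_of_nonneg fun _ => sq_nonneg _).1 (by simpa using h1)
    have h3 : ⟪w, v k⟫_ℂ = 0 := by simpa using congrFun h2 k
    have h4 : ⟪w, w⟫_ℂ = 0 := by
      nth_rw 2 [hw]
      rw [inner_sub_right, inner_smul_right, h3, hwg]; simp
    have h5 : v k = ⟪g, v k⟫_ℂ • g := sub_eq_zero.1 (inner_self_eq_zero.1 h4)
    rw [h5, norm_smul, hg, mul_one, inner_smul_right, hgg, mul_one]
  have := hφ g
  simp only [hv] at this
  rw [inner_self_eq_norm_sq_to_K, hg] at this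
  simpa using this

lemma norm_le_sqrt_of_hasSum_inner {κ : Type*} {a b : κ → H} {z : ℂ} {p q : ℝ}
    (h : HasSum (fun k => ⟪a k, b k⟫_ℂ) z) (ha : HasSum (fun k => ‖a k‖ ^ 2) p)
    (hb : HasSum (fun k => ‖b k‖ ^ 2) q) : ‖z‖ ≤ √(p * q) := by
  refine le_of_tendsto h.norm (.of_forall fun s => ?_)
  calc ‖∑ k ∈ s, ⟪a k, b k⟫_ℂ‖ ≤ ∑ k ∈ s, ‖a k‖ * ‖b k‖ :=
        (norm_sum_le _ _).trans (Finset.sum_le_sum fun k _ => norm_inner_le_norm _ _)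
    _ ≤ √(∑ k ∈ s, ‖a k‖ ^ 2) * √(∑ k ∈ s, ‖b k‖ ^ 2) :=
        Real.sum_mul_le_sqrt_mul_sqrt _ _ _
    _ ≤ √p * √q := by
        gcongr
        · exact sum_le_hasSum _ (fun _ _ => sq_nonneg _) ha
        · exact sum_le_hasSum _ (fun _ _ => sq_nonneg _) hb
    _ = √(p * q) := (Real.sqrt_mul (ha.nonneg fun _ => sq_nonneg _) q).symm

lemma hasSum_inner_of_hasSum_norm_sq {κ : Type*} {K : κ → H →L[ℂ] H}
    (h : ∀ ψ : H, HasSum (fun k => ‖K k ψ‖ ^ 2) (‖ψ‖ ^ 2)) (φ ψ : H) :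
    HasSum (fun k => ⟪K k φ, K k ψ⟫_ℂ) ⟪φ, ψ⟫_ℂ := by
  have hC : ∀ ψ : H, HasSum (fun k => (‖K k ψ‖ : ℂ) ^ 2) ((‖ψ‖ : ℂ) ^ 2) := fun ψ => by
    simpa using (h ψ).mapL Complex.ofRealCLM
  have := (((hC (φ + ψ)).sub (hC (φ - ψ))).add
    (((hC (φ - Complex.I • ψ)).sub (hC (φ + Complex.I • ψ))).mul_right Complex.I)).div_const 4
  simp only [map_add, map_sub, map_smul] at this
  rw [inner_eq_sum_norm_sq_div_four]
  simp only [inner_eq_sum_norm_sq_div_four (𝕜 := ℂ)]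
  exact this

variable {A : Type} [Fintype A] [MeasurableSpace A] [DiscreteMeasurableSpace A] [Nonempty A]

/-- The overlap of two memory states is at most the Bhattacharyya coefficient of the conditional
laws of the next output: a measurement cannot decrease the fidelity below that of its outcomes. -/
lemma QuantumTuple.IsModel.norm_inner_encode_le {Q : QuantumTuple A H} {P : Measure (ℤ → A)}
    [IsFiniteMeasure P] (hQ : Q.IsModel P) {y y' : ℕ → A}
    (hy : ∀ x : A, HasSum (fun k => ketBra (Q.kraus x k (Q.encode y)) (Q.kraus x k (Q.encode y)))
      ((nextProb P y x : ℂ) • ketBra (Q.encode (extendPast y x)) (Q.encode (extendPast y x))))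
    (hy' : ∀ x : A,
      HasSum (fun k => ketBra (Q.kraus x k (Q.encode y')) (Q.kraus x k (Q.encode y')))
      ((nextProb P y' x : ℂ) •
        ketBra (Q.encode (extendPast y' x)) (Q.encode (extendPast y' x)))) :
    ‖⟪Q.encode y, Q.encode y'⟫_ℂ‖ ≤ ∑ x, √(nextProb P y x * nextProb P y' x) := by
  have h := hasSum_inner_of_hasSum_norm_sq hQ.complete (Q.encode y) (Q.encode y')
  have hfib : ∀ x, Summable fun k => ⟪Q.kraus x k (Q.encode y), Q.kraus x k (Q.encode y')⟫_ℂ :=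
    fun x => h.summable.prod_factor x
  have h2 := (h.prod_fiberwise fun x => (hfib x).hasSum).unique (hasSum_fintype _)
  rw [h2]
  refine (norm_sum_le _ _).trans (Finset.sum_le_sum fun x _ => ?_)
  exact norm_le_sqrt_of_hasSum_inner (hfib x).hasSum
    (hasSum_norm_sq_of_hasSum_ketBra (hQ.norm_encode _) (hy x))
    (hasSum_norm_sq_of_hasSum_ketBra (hQ.norm_encode _) (hy' x))

end Overlap

/-! ### Cylinder sets -/

section Cylinders

variable {ι A : Type*} {F : ℕ → Finset ι}

/-- The sequences that agree with `w` on one of the finite windows `F n`. -/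
def windowCylinders (A : Type*) (F : ℕ → Finset ι) : Set (Set (ι → A)) :=
  {S | ∃ (n : ℕ) (w : ι → A), S = {x | ∀ i ∈ F n, x i = w i}}

lemma isPiSystem_windowCylinders (hF : Monotone F) : IsPiSystem (windowCylinders A F) := by
  rintro _ ⟨n, w, rfl⟩ _ ⟨m, v, rfl⟩ ⟨z, hzw, hzv⟩
  refine ⟨max n m, z, Set.ext fun x => ⟨fun ⟨h1, h2⟩ i hi => ?_, fun h => ⟨fun i hi => ?_,
    fun i hi => ?_⟩⟩⟩
  · rcases le_total n m with h | h
    · rw [max_eq_right h] at hi; rw [h2 i hi, hzv i hi]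
    · rw [max_eq_left h] at hi; rw [h1 i hi, hzw i hi]
  · rw [h i (hF (le_max_left _ _) hi), hzw i hi]
  · rw [h i (hF (le_max_right _ _) hi), hzv i hi]

variable [MeasurableSpace A] [Countable A] [DiscreteMeasurableSpace A]

lemma measurableSet_windowCylinder (s : Finset ι) (w : ι → A) :
    MeasurableSet {x : ι → A | ∀ i ∈ s, x i = w i} := by
  have : {x : ι → A | ∀ i ∈ s, x i = w i} = ⋂ i ∈ s, (fun x => x i) ⁻¹' {w i} := by ext; simp
  rw [this]
  exact s.measurableSet_biInter fun i _ => measurable_pi_apply i (measurableSet_singleton _)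

lemma generateFrom_windowCylinders (hF : ∀ i, ∃ n, i ∈ F n) :
    (MeasurableSpace.pi : MeasurableSpace (ι → A)) =
      MeasurableSpace.generateFrom (windowCylinders A F) := by
  classical
  refine le_antisymm (iSup_le fun i => ?_) (MeasurableSpace.generateFrom_le ?_)
  · obtain ⟨n, hn⟩ := hF i
    rw [← measurable_iff_comap_le]
    refine @measurable_to_countable' A (ι → A) _ _ (MeasurableSpace.generateFrom _) _ fun a => ?_
    have : (fun x : ι → A => x i) ⁻¹' {a} = ⋃ w ∈ {w : F n → A | w ⟨i, hn⟩ = a},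
        {x | ∀ j ∈ F n, x j = if h : j ∈ F n then w ⟨j, h⟩ else a} := by
      ext x
      simp only [Set.mem_preimage, Set.mem_singleton_iff, Set.mem_iUnion, Set.mem_ofPred_eq,
        exists_prop]
      refine ⟨fun h => ⟨fun j => x j, h, fun j hj => by simp [hj]⟩, ?_⟩
      rintro ⟨w, hw, h⟩
      rw [h i hn, dif_pos hn, hw]
    rw [this]
    refine MeasurableSet.biUnion (Set.to_countable _) fun w _ => ?_
    exact MeasurableSpace.measurableSet_generateFrom ⟨n, _, rfl⟩
  · rintro _ ⟨n, w, rfl⟩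
    exact measurableSet_windowCylinder _ _

lemma measure_ext_of_windowCylinders (hF : Monotone F) (hF' : ∀ i, ∃ n, i ∈ F n)
    {μ ν : Measure (ι → A)} [IsFiniteMeasure μ] (huniv : μ Set.univ = ν Set.univ)
    (h : ∀ (n : ℕ) (w : ι → A),
      μ {x | ∀ i ∈ F n, x i = w i} = ν {x | ∀ i ∈ F n, x i = w i}) : μ = ν :=
  ext_of_generate_finite _ (generateFrom_windowCylinders hF') (isPiSystem_windowCylinders hF)
    (by rintro _ ⟨n, w, rfl⟩; exact h n w) huniv

end Cylinders

/-! ### Stationary Markov chains -/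

/-- `P` is the law of the two-sided Markov chain with transition matrix `T` and one-time marginals
`π`. -/
def IsMarkovLaw {A : Type} [MeasurableSpace A] (π : A → ℝ) (T : A → A → ℝ)
    (P : Measure (ℤ → A)) : Prop :=
  ∀ (t : ℤ) (n : ℕ) (w : ℕ → A),
    P {x | ∀ i ≤ n, x (t + i) = w i} =
      ENNReal.ofReal (π (w 0) * ∏ i ∈ Finset.range n, T (w i) (w (i + 1)))

section Markov

variable {A : Type} [MeasurableSpace A] {π : A → ℝ} {T : A → A → ℝ} {P : Measure (ℤ → A)}

lemma measurable_past : Measurable (past : (ℤ → A) → ℕ → A) :=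
  measurable_pi_lambda _ fun _ => measurable_pi_apply _

lemma measurable_future : Measurable (future : (ℤ → A) → ℕ → A) :=
  measurable_pi_lambda _ fun _ => measurable_pi_apply _

lemma measurable_reversePath : Measurable (reversePath : (ℤ → A) → ℤ → A) :=
  measurable_pi_lambda _ fun _ => measurable_pi_apply _

instance isProbabilityMeasure_pastLaw [IsProbabilityMeasure P] :
    IsProbabilityMeasure (pastLaw P) :=
  Measure.isProbabilityMeasure_map measurable_past.aemeasurable

lemma IsMarkovLaw.measure_eq (hP : IsMarkovLaw π T P) (t : ℤ) (a : A) :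
    P {x | x t = a} = ENNReal.ofReal (π a) := by
  have := hP t 0 fun _ => a
  simpa using this

/-- The Markov property for cylinder sets. -/
lemma IsMarkovLaw.measure_window_add (hP : IsMarkovLaw π T P) (hπ : ∀ a, 0 ≤ π a)
    (hT : ∀ a b, 0 ≤ T a b) (t : ℤ) (m k : ℕ) (u : ℕ → A) :
    P {x | ∀ i ≤ m + k, x (t + i) = u i} * P {x | x (t + m) = u m} =
      P {x | ∀ i ≤ m, x (t + i) = u i} * P {x | ∀ i ≤ k, x (t + m + i) = u (m + i)} := by
  have h := hP (t + m) k fun i => u (m + i)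
  simp only [add_zero] at h
  have hprod : ∀ (n : ℕ) (w : ℕ → A), 0 ≤ ∏ i ∈ Finset.range n, T (w i) (w (i + 1)) :=
    fun n w => Finset.prod_nonneg fun _ _ => hT _ _
  rw [hP t, hP t, hP.measure_eq, h, ← ENNReal.ofReal_mul (mul_nonneg (hπ _) (hprod _ _)),
    ← ENNReal.ofReal_mul (mul_nonneg (hπ _) (hprod _ _)), Finset.prod_range_add]
  congr 1
  simp only [add_assoc]
  ring

variable [Fintype A] [DiscreteMeasurableSpace A]

lemma range_succ_mono : Monotone fun n : ℕ => Finset.range (n + 1) :=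
  fun _ _ h => Finset.range_subset_range.2 (by omega)

lemma exists_mem_range_succ (i : ℕ) : ∃ n : ℕ, i ∈ Finset.range (n + 1) :=
  ⟨i, by simp⟩

lemma measurableSet_window (t : ℤ) (n : ℕ) (w : ℕ → A) :
    MeasurableSet {x : ℤ → A | ∀ i ≤ n, x (t + i) = w i} := by
  have : {x : ℤ → A | ∀ i ≤ n, x (t + i) = w i} =
      ⋂ i ∈ Finset.range (n + 1), (fun x => x (t + i)) ⁻¹' {w i} := by
    ext; simp
  rw [this]
  exact Finset.measurableSet_biInter _ fun i _ =>
    measurable_pi_apply _ (measurableSet_singleton _)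

lemma IsMarkovLaw.pastLaw_real (hP : IsMarkovLaw π T P) (hπ : ∀ a, 0 ≤ π a) (a : A) :
    (pastLaw P).real ((fun y => y 0) ⁻¹' {a}) = π a := by
  rw [measureReal_def, pastLaw,
    Measure.map_apply measurable_past (measurable_pi_apply 0 (measurableSet_singleton a))]
  have : past ⁻¹' ((fun y : ℕ → A => y 0) ⁻¹' {a}) = {x | x (-1) = a} := by
    ext; simp [past]
  rw [this, hP.measure_eq, ENNReal.toReal_ofReal (hπ a)]

/-- The law of a Markov chain is stationary. -/
lemma IsMarkovLaw.isStationaryLaw [IsProbabilityMeasure P] (hP : IsMarkovLaw π T P) :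
    IsStationaryLaw P := by
  have hm : Measurable fun (x : ℤ → A) (t : ℤ) => x (t + 1) :=
    measurable_pi_lambda _ fun _ => measurable_pi_apply _
  have : IsProbabilityMeasure (P.map fun x t => x (t + 1)) :=
    Measure.isProbabilityMeasure_map hm.aemeasurable
  refine measure_ext_of_windowCylinders (F := fun n : ℕ => Finset.Icc (-n : ℤ) n) ?_ ?_
    (by simp) ?_
  · exact fun m n h => Finset.Icc_subset_Icc (by omega) (by omega)
  · exact fun i => ⟨i.natAbs, Finset.mem_Icc.2 ⟨by omega, by omega⟩⟩
  · intro n w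
    have hw : ∀ s : ℤ, {x : ℤ → A | ∀ i ∈ Finset.Icc (-n : ℤ) n, x (i + s) = w i} =
        {x | ∀ i ≤ 2 * n, x (-n + s + (i : ℕ)) = w (-n + i)} := by
      intro s
      ext x
      refine ⟨fun h i hi => ?_, fun h i hi => ?_⟩
      · rw [← h (-n + i) (by simp; omega)]; congr 1; ring
      · simp only [Finset.mem_Icc] at hi
        have := h (i + n).toNat (by omega)
        rw [Int.toNat_of_nonneg (by omega)] at this
        rw [← show (-n + (i + n) : ℤ) = i by ring, ← this]; congr 1; ring
    rw [Measure.map_apply hm (measurableSet_windowCylinder _ _)]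
    have h1 := hw 1
    have h0 := hw 0
    simp only [add_zero] at h0
    change P {x | ∀ i ∈ Finset.Icc (-n : ℤ) n, x (i + 1) = w i} = _
    rw [h0, h1, hP (-n + 1) (2 * n) fun i => w (-n + i),
      hP (-n) (2 * n) fun i => w (-n + i)]

/-- Past and future of a Markov chain are independent, given the present symbol. -/
lemma IsMarkovLaw.indepFun_past_future [IsProbabilityMeasure P] (hP : IsMarkovLaw π T P)
    (hπ : ∀ a, 0 ≤ π a) (hT : ∀ a b, 0 ≤ T a b) (a : A) :
    IndepFun past future P[|{x | x (-1) = a}] := by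
  rw [IndepFun_iff_Indep]
  have hma : MeasurableSet {x : ℤ → A | x (-1) = a} :=
    (measurable_pi_apply (-1) : Measurable fun x : ℤ → A => x (-1)) (measurableSet_singleton a)
  have hgen := generateFrom_windowCylinders (A := A) exists_mem_range_succ
  have hpi := isPiSystem_windowCylinders (A := A) range_succ_mono
  refine IndepSets.indep (p1 := (past ⁻¹' ·) '' windowCylinders A fun n => Finset.range (n + 1))
    (p2 := (future ⁻¹' ·) '' windowCylinders A fun n => Finset.range (n + 1))
    measurable_past.comap_le measurable_future.comap_le (hpi.comap _) (hpi.comap _)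
    (by rw [hgen, MeasurableSpace.comap_generateFrom])
    (by rw [hgen, MeasurableSpace.comap_generateFrom]) ?_
  rw [IndepSets_iff]
  rintro _ _ ⟨_, ⟨m, v, rfl⟩, rfl⟩ ⟨_, ⟨n, w, rfl⟩, rfl⟩
  set C := past ⁻¹' {y : ℕ → A | ∀ i ∈ Finset.range (m + 1), y i = v i} with hC
  set D := future ⁻¹' {y : ℕ → A | ∀ i ∈ Finset.range (n + 1), y i = w i} with hD
  simp only [cond_apply hma]
  by_cases hv : v 0 = a
  swap
  · have : {x : ℤ → A | x (-1) = a} ∩ C = ∅ := by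
      ext x
      simp only [Set.mem_inter_iff, Set.mem_ofPred_eq, Set.mem_empty_iff_false, iff_false, not_and]
      intro h h'
      have := h' 0 (by simp)
      exact hv (this.symm.trans h)
    rw [← Set.inter_assoc, this]
    simp only [Set.empty_inter, measure_empty, mul_zero, zero_mul]
  by_cases h0 : P {x | x (-1) = a} = 0
  · have hz : ∀ S, P ({x | x (-1) = a} ∩ S) = 0 := fun S =>
      measure_mono_null Set.inter_subset_left h0
    simp [hz]
  -- the word consisting of the reversed past `v` and the future `w`
  set u : ℕ → A := fun i => if i ≤ m then v (m - i) else w (i - m - 1) with hu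
  have hum : u m = a := by simp [hu, hv]
  have key := hP.measure_window_add hπ hT (-(m + 1)) m (n + 1) u
  have eC : {x : ℤ → A | ∀ i ≤ m, x (-(m + 1) + (i : ℕ)) = u i} = C := by
    ext x
    refine ⟨fun h i hi => ?_, fun h i hi => ?_⟩
    · have hi' : i ≤ m := by simpa [Nat.lt_succ_iff] using hi
      have := h (m - i) (by omega)
      rw [hu] at this
      simp only [show m - i ≤ m by omega, if_true, show m - (m - i) = i by omega] at this
      rw [← this, past]; congr 1; push_cast [hi']; ring
    · have := h (m - i) (by simp)
      rw [hu]
      simp only [hi, if_true]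
      rw [← this, past]; congr 1; push_cast [hi]; ring
  have e1 : (-(m + 1) + m : ℤ) = -1 := by ring
  have eD : {x : ℤ → A | ∀ i ≤ n + 1, x (-(m + 1) + m + (i : ℕ)) = u (m + i)} =
      {x | x (-1) = a} ∩ D := by
    ext x
    simp only [e1]
    refine ⟨fun h => ⟨?_, fun i hi => ?_⟩, fun ⟨h, h'⟩ i hi => ?_⟩
    · have := h 0 (by omega)
      simpa [hum] using this
    · have := h (i + 1) (by simpa using hi)
      rw [hu] at this
      simp only [show ¬ (m + (i + 1) ≤ m) by omega, if_false,
        show m + (i + 1) - m - 1 = i by omega] at this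
      rw [← this, future]; congr 1; push_cast; ring
    · rcases i with _ | i
      · simpa [hum] using h
      · have := h' i (by simp; omega)
        rw [hu]
        simp only [show ¬ (m + (i + 1) ≤ m) by omega, if_false,
          show m + (i + 1) - m - 1 = i by omega]
        rw [← this, future]; congr 1; push_cast; ring
  have eCD : {x : ℤ → A | ∀ i ≤ m + (n + 1), x (-(m + 1) + (i : ℕ)) = u i} = C ∩ D := by
    rw [← eC]
    ext x
    refine ⟨fun h => ⟨fun i hi => h i (by omega), ?_⟩, fun ⟨h, h'⟩ i hi => ?_⟩
    · have : x ∈ {x : ℤ → A | x (-1) = a} ∩ D := by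
        rw [← eD]
        intro i hi
        rw [← h (m + i) (by omega)]; congr 1; push_cast; ring
      exact this.2
    · by_cases him : i ≤ m
      · exact h i him
      · have hx : x ∈ {x : ℤ → A | x (-1) = a} ∩ D := by
          refine ⟨?_, h'⟩
          have := h m le_rfl
          rwa [e1, hum] at this
        rw [← eD] at hx
        have := hx (i - m) (by omega)
        rw [show m + (i - m) = i by omega] at this
        rw [← this]; congr 1; push_cast [show m ≤ i by omega]; ring
  have eaC : {x : ℤ → A | x (-1) = a} ∩ C = C := by
    refine Set.inter_eq_right.2 fun x hx => ?_
    have := hx 0 (by simp)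
    exact this.trans hv
  have e2 : {x : ℤ → A | x (-(m + 1) + m) = u m} = {x | x (-1) = a} := by rw [e1, hum]
  rw [eCD, eC, eD, e2] at key
  rw [← Set.inter_assoc, eaC]
  set z := P {x | x (-1) = a} with hz
  have hzt : z ≠ ∞ := measure_ne_top _ _
  calc z⁻¹ * P (C ∩ D) = z⁻¹ * z⁻¹ * (P (C ∩ D) * z) := by
        rw [mul_assoc, mul_comm (P _) z, ← mul_assoc z⁻¹ z, ENNReal.inv_mul_cancel h0 hzt, one_mul]
    _ = z⁻¹ * P C * (z⁻¹ * P ({x | x (-1) = a} ∩ D)) := by rw [key]; ring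

end Markov

/-! ### Conditional futures and causal states of a Markov chain -/

section CausalStates

variable {A : Type} [Fintype A] [MeasurableSpace A] [DiscreteMeasurableSpace A]
  {π : A → ℝ} {T : A → A → ℝ} {P : Measure (ℤ → A)}

/-- The law of the future, conditioned on the last symbol of the past. -/
noncomputable def futureFrom (P : Measure (ℤ → A)) (a : A) : Measure (ℕ → A) :=
  P[|{x | x (-1) = a}].map future

/-- `futureFrom P` as a kernel on pasts. -/
noncomputable def futureKernel (P : Measure (ℤ → A)) : Kernel (ℕ → A) (ℕ → A) where
  toFun y := futureFrom P (y 0)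
  measurable' := (measurable_of_countable (futureFrom P)).comp (measurable_pi_apply 0)

lemma futureKernel_apply (y : ℕ → A) : futureKernel P y = futureFrom P (y 0) := rfl

lemma measurableSet_last (a : A) : MeasurableSet {x : ℤ → A | x (-1) = a} :=
  (measurable_pi_apply (-1) : Measurable fun x : ℤ → A => x (-1)) (measurableSet_singleton a)

instance [IsProbabilityMeasure P] : IsFiniteKernel (futureKernel P) := by
  refine ⟨⟨1, ENNReal.one_lt_top, fun y => ?_⟩⟩
  rw [futureKernel_apply, futureFrom, Measure.map_apply measurable_future .univ, Set.preimage_univ]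
  exact prob_le_one

lemma IsMarkovLaw.map_past_future [IsProbabilityMeasure P] (hP : IsMarkovLaw π T P)
    (hπ : ∀ a, 0 ≤ π a) (hT : ∀ a b, 0 ≤ T a b) :
    P.map (fun x => (past x, future x)) = P.map past ⊗ₘ futureKernel P := by
  have hpf : Measurable fun x : ℤ → A => (past x, future x) :=
    measurable_past.prodMk measurable_future
  have : IsProbabilityMeasure (P.map fun x : ℤ → A => (past x, future x)) :=
    Measure.isProbabilityMeasure_map hpf.aemeasurable
  refine Measure.ext_prod fun {S} {B} hS hB => ?_
  have hS' := measurable_past (A := A) hS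
  have hB' := measurable_future (A := A) hB
  rw [Measure.map_apply hpf (hS.prod hB), Measure.compProd_apply_prod hS hB,
    setLIntegral_map hS (Kernel.measurable_coe _ hB) measurable_past]
  have hlast : Measurable fun x : ℤ → A => x (-1) := measurable_pi_apply _
  have hfib : ∀ (g : A → ℝ≥0∞) (E : Set (ℤ → A)), MeasurableSet E →
      ∫⁻ x in E, g (x (-1)) ∂P = ∑ a, g a * P ({x | x (-1) = a} ∩ E) := by
    intro g E hE
    rw [← lintegral_map (f := g) (measurable_of_countable g) hlast, lintegral_fintype]
    refine Finset.sum_congr rfl fun a _ => ?_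
    rw [Measure.map_apply hlast (measurableSet_singleton a), Measure.restrict_apply
      (hlast (measurableSet_singleton a))]
    rfl
  have h1 := hfib (fun _ => 1) _ (hS'.inter hB')
  simp only [setLIntegral_one, one_mul] at h1
  change P (past ⁻¹' S ∩ future ⁻¹' B) = ∫⁻ x in past ⁻¹' S, futureFrom P (x (-1)) B ∂P
  rw [h1, hfib (fun a => futureFrom P a B) _ hS']
  refine Finset.sum_congr rfl fun a _ => ?_
  have hind := (hP.indepFun_past_future hπ hT a).measure_inter_preimage_eq_mul _ _ hS hB
  rw [futureFrom, Measure.map_apply measurable_future hB,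
    ← cond_mul_eq_inter (measurableSet_last a), hind, ← cond_mul_eq_inter (measurableSet_last a)]
  ring

lemma IsMarkovLaw.futureFrom_cylinder [IsProbabilityMeasure P] (hP : IsMarkovLaw π T P)
    (hπ : ∀ a, 0 ≤ π a) {a : A} (ha : π a ≠ 0) (n : ℕ) (w : ℕ → A) :
    futureFrom P a {z | ∀ i ∈ Finset.range (n + 1), z i = w i} =
      ENNReal.ofReal (T a (w 0) * ∏ i ∈ Finset.range n, T (w i) (w (i + 1))) := by
  have hpos : 0 < π a := (hπ a).lt_of_ne' ha
  rw [futureFrom, Measure.map_apply measurable_future (measurableSet_windowCylinder _ _),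
    cond_apply (measurableSet_last a), hP.measure_eq]
  have e : {x : ℤ → A | x (-1) = a} ∩
      future ⁻¹' {z | ∀ i ∈ Finset.range (n + 1), z i = w i} =
      {x | ∀ i ≤ n + 1, x (-1 + (i : ℕ)) = (fun i => Nat.casesOn i a w : ℕ → A) i} := by
    ext x
    refine ⟨fun ⟨h, h'⟩ i hi => ?_, fun h => ⟨by simpa using h 0 (by omega), fun i hi => ?_⟩⟩
    · rcases i with _ | i
      · simpa using h
      · have := h' i (by simp; omega)
        simp only [← this, future]
        congr 1; push_cast; ring
    · have := h (i + 1) (by simpa using hi)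
      simp only at this
      rw [← this, future]
      congr 1; push_cast; ring
  rw [e, hP, Finset.prod_range_succ', ← ENNReal.ofReal_inv_of_pos hpos,
    ← ENNReal.ofReal_mul (inv_nonneg.2 hpos.le)]
  congr 1
  field_simp
  rfl

lemma IsMarkovLaw.futureFrom_real [IsProbabilityMeasure P] (hP : IsMarkovLaw π T P)
    (hπ : ∀ a, 0 ≤ π a) (hT : ∀ a b, 0 ≤ T a b) {a : A} (ha : π a ≠ 0) (x : A) :
    (futureFrom P a).real {z | z 0 = x} = T a x := by
  have := hP.futureFrom_cylinder hπ ha 0 fun _ => x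
  simp only [zero_add, Finset.range_one, Finset.mem_singleton, forall_eq, Finset.range_zero,
    Finset.prod_empty, mul_one] at this
  rw [measureReal_def, this, ENNReal.toReal_ofReal (hT _ _)]

/-- Two symbols have the same conditional future if and only if they have the same transition
probabilities. -/
lemma IsMarkovLaw.futureFrom_eq_iff [IsProbabilityMeasure P] (hP : IsMarkovLaw π T P)
    (hπ : ∀ a, 0 ≤ π a) (hT : ∀ a b, 0 ≤ T a b) {a b : A} (ha : π a ≠ 0) (hb : π b ≠ 0) :
    futureFrom P a = futureFrom P b ↔ T a = T b := by
  refine ⟨fun h => ?_, fun h => ?_⟩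
  · funext x
    rw [← hP.futureFrom_real hπ hT ha, ← hP.futureFrom_real hπ hT hb, h]
  · have hprob : ∀ c, π c ≠ 0 → IsProbabilityMeasure (futureFrom P c) := by
      intro c hc
      have : IsProbabilityMeasure P[|{x | x (-1) = c}] := by
        refine cond_isProbabilityMeasure ?_
        rw [hP.measure_eq]
        simpa using (hπ c).lt_of_ne' hc
      exact Measure.isProbabilityMeasure_map measurable_future.aemeasurable
    have := hprob a ha
    have := hprob b hb
    refine measure_ext_of_windowCylinders range_succ_mono exists_mem_range_succ (by simp) ?_
    intro n w
    rw [hP.futureFrom_cylinder hπ ha, hP.futureFrom_cylinder hπ hb, h]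

lemma IsMarkovLaw.ae_ne_zero (hP : IsMarkovLaw π T P) :
    ∀ᵐ y ∂pastLaw P, π (y 0) ≠ 0 := by
  have hm : Measurable fun y : ℕ → A => y 0 := measurable_pi_apply 0
  have h : ∀ a, π a = 0 → ∀ᵐ y ∂pastLaw P, y 0 ≠ a := by
    intro a ha
    simp only [ae_iff, ne_eq, not_not]
    have hS : MeasurableSet {y : ℕ → A | y 0 = a} := hm (measurableSet_singleton a)
    rw [pastLaw, Measure.map_apply measurable_past hS]
    have := hP.measure_eq (-1) a
    simpa [ha, past] using this
  have h' : ∀ᵐ y ∂pastLaw P, ∀ a, π a = 0 → y 0 ≠ a := by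
    rw [ae_all_iff]
    intro a
    by_cases ha : π a = 0
    · filter_upwards [h a ha] with y hy _ using hy
    · exact .of_forall fun y h => absurd h ha
  filter_upwards [h'] with y hy h0
  exact hy _ h0 rfl

variable [Nonempty A]

lemma IsMarkovLaw.futureGiven_ae_eq [IsProbabilityMeasure P] (hP : IsMarkovLaw π T P)
    (hπ : ∀ a, 0 ≤ π a) (hT : ∀ a b, 0 ≤ T a b) :
    ∀ᵐ y ∂pastLaw P, futureGiven P y = futureFrom P (y 0) :=
  condDistrib_ae_eq_of_measure_eq_compProd past measurable_future.aemeasurable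
    (hP.map_past_future hπ hT)

lemma IsMarkovLaw.nextProb_ae_eq [IsProbabilityMeasure P] (hP : IsMarkovLaw π T P)
    (hπ : ∀ a, 0 ≤ π a) (hT : ∀ a b, 0 ≤ T a b) :
    ∀ᵐ y ∂pastLaw P, ∀ x, nextProb P y x = T (y 0) x := by
  filter_upwards [hP.futureGiven_ae_eq hπ hT, hP.ae_ne_zero] with y hy h0 x
  rw [nextProb, hy, hP.futureFrom_real hπ hT h0]

/-- The statistical complexity of a Markov chain. The map `g` labels the symbols by their causal
states: symbols of positive probability have the same label if and only if they have the same
transition probabilities. -/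
lemma IsMarkovLaw.classicalComplexity_eq [IsProbabilityMeasure P] (hP : IsMarkovLaw π T P)
    (hπ : ∀ a, 0 ≤ π a) (hT : ∀ a b, 0 ≤ T a b) {B : Type} [Fintype B] [DecidableEq B]
    [MeasurableSpace B] [DiscreteMeasurableSpace B] (g : A → B)
    (hg : ∀ a a', π a ≠ 0 → π a' ≠ 0 → (T a = T a' ↔ g a = g a')) :
    classicalComplexity P = ENNReal.ofReal (∑ b, eta (∑ a with g a = b, π a)) := by
  classical
  have hae := hP.futureGiven_ae_eq hπ hT
  have hne := hP.ae_ne_zero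
  set πB : B → ℝ := fun b => ∑ a with g a = b, π a with hπB
  have hm : Measurable fun y : ℕ → A => y 0 := measurable_pi_apply 0
  have hreal : ∀ b, (pastLaw P).real {y | g (y 0) = b} = πB b := by
    intro b
    have : {y : ℕ → A | g (y 0) = b} =
        ⋃ a ∈ Finset.univ.filter (g · = b), (fun y : ℕ → A => y 0) ⁻¹' {a} := by
      ext y; simp
    rw [this, measureReal_biUnion_finset]
    · exact Finset.sum_congr rfl fun a _ => hP.pastLaw_real hπ a
    · intro a _ a' _ h
      exact Set.disjoint_left.2 fun y hy hy' => h (hy.symm.trans hy')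
    · exact fun a _ => hm (measurableSet_singleton a)
  set s : Finset B := (Finset.univ.filter fun a => π a ≠ 0).image g with hs
  have hrep : ∀ b, ∃ a, b ∈ s → π a ≠ 0 ∧ g a = b := by
    intro b
    by_cases hb : b ∈ s
    · obtain ⟨a, ha, rfl⟩ := Finset.mem_image.1 hb
      exact ⟨a, fun _ => ⟨(Finset.mem_filter.1 ha).2, rfl⟩⟩
    · exact ⟨Classical.arbitrary A, fun h => absurd h hb⟩
  choose r hr using hrep
  set e : B → Measure (ℕ → A) := fun b => futureFrom P (r b) with he
  have hiff : ∀ a, π a ≠ 0 → ∀ b ∈ s, (futureFrom P a = e b ↔ g a = b) := by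
    intro a ha b hb
    rw [he, hP.futureFrom_eq_iff hπ hT ha (hr b hb).1, hg _ _ ha (hr b hb).1, (hr b hb).2]
  have hmem : ∀ a, π a ≠ 0 → g a ∈ s := fun a ha =>
    Finset.mem_image.2 ⟨a, by simpa using ha, rfl⟩
  have hinj : Set.InjOn e s := by
    intro b hb b' hb' h
    have := (hiff (r b) (hr b hb).1 b' hb').1 h
    rw [← this, (hr b hb).2]
  have hcs : ∀ b ∈ s, pastLaw P (causalState P (e b)) = pastLaw P {y | g (y 0) = b} := by
    intro b hb
    refine measure_congr ?_
    filter_upwards [hae, hne] with y hy h0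
    refine propext ?_
    change futureGiven P y = e b ↔ g (y 0) = b
    rw [hy, hiff _ h0 b hb]
  have hcs0 : ∀ m ∉ s.image e, pastLaw P (causalState P m) = 0 := by
    intro m hm
    refine measure_eq_zero_iff_ae_notMem.2 ?_
    filter_upwards [hae, hne] with y hy h0 hym
    refine hm (Finset.mem_image.2 ⟨g (y 0), hmem _ h0, ?_⟩)
    rw [← (hiff _ h0 _ (hmem _ h0)).2 rfl, ← hy]
    exact hym
  have hout : ∀ b ∉ s, πB b = 0 := by
    intro b hb
    refine Finset.sum_eq_zero fun a ha => ?_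
    by_contra h
    exact hb ((Finset.mem_filter.1 ha).2 ▸ hmem a h)
  have htot : ∑ b ∈ s, πB b = 1 := by
    rw [Finset.sum_subset (Finset.subset_univ s) fun b _ hb => hout b hb, hπB,
      Finset.sum_fiberwise]
    have h1 : ∑ a, (pastLaw P).real ((fun y => y 0) ⁻¹' {a}) = 1 := by
      rw [← measureReal_biUnion_finset (fun a _ a' _ h => Set.disjoint_left.2
        fun y hy hy' => h (hy.symm.trans hy')) fun a _ => hm (measurableSet_singleton a)]
      have : (⋃ b ∈ Finset.univ, (fun y : ℕ → A => y 0) ⁻¹' {b}) = Set.univ := by ext; simp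
      rw [this, probReal_univ]
    rw [← h1]
    exact Finset.sum_congr rfl fun a _ => (hP.pastLaw_real hπ a).symm
  have hπB0 : ∀ b, 0 ≤ πB b := fun b => Finset.sum_nonneg fun a _ => hπ a
  have hπB1 : ∀ b, πB b ≤ 1 := by
    intro b
    rw [← hreal]
    exact measureReal_le_one
  have hexh : ∑' m : Measure (ℕ → A), pastLaw P (causalState P m) = pastLaw P Set.univ := by
    rw [tsum_eq_sum hcs0, Finset.sum_image hinj, Finset.sum_congr rfl hcs, measure_univ,
      ← ENNReal.ofReal_one, ← htot, ENNReal.ofReal_sum_of_nonneg fun b _ => hπB0 b]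
    exact Finset.sum_congr rfl fun b _ => by rw [← hreal, ofReal_measureReal]
  rw [classicalComplexity, if_pos hexh, tsum_eq_sum (s := s.image e) fun m hm => by
    rw [measureReal_def, hcs0 m hm]; simp [eta_zero], Finset.sum_image hinj,
    ENNReal.ofReal_sum_of_nonneg fun b _ => eta_nonneg (hπB0 b) (hπB1 b),
    ← Finset.sum_subset (Finset.subset_univ s) fun b _ hb => by simp [hout b hb, eta_zero]]
  exact Finset.sum_congr rfl fun b hb => by rw [measureReal_def, hcs b hb, ← measureReal_def, hreal]

end CausalStates

/-! ### Optimal quantum models of Markov chains -/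

/-- The larger eigenvalue of a symmetric `2 × 2` matrix of trace one. -/
lemma quadratic_form_le {a b m D : ℝ} (htr : a + b = 1) (hD : D = a * b - m ^ 2) (x y : ℝ) :
    a * x ^ 2 + 2 * m * (x * y) + b * y ^ 2 ≤ (1 + √(1 - 4 * D)) / 2 * (x ^ 2 + y ^ 2) := by
  have hr : 1 - 4 * D = (a - b) ^ 2 + 4 * m ^ 2 := by
    rw [hD]; linear_combination (-a - b - 1) * htr
  rw [hr]
  set r := √((a - b) ^ 2 + 4 * m ^ 2) with hr'
  have hr2 : r ^ 2 = (a - b) ^ 2 + 4 * m ^ 2 := Real.sq_sqrt (by positivity)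
  have hab : |a - b| ≤ r := Real.abs_le_sqrt (by nlinarith [sq_nonneg m])
  have h1 := (abs_le.1 hab).1
  have h2 := (abs_le.1 hab).2
  set u := (1 + r) / 2 - a with hu
  set v := (1 + r) / 2 - b with hv
  have hu0 : 0 ≤ u := by rw [hu]; linarith
  have hv0 : 0 ≤ v := by rw [hv]; linarith
  have huv : u * v = m ^ 2 := by
    have e1 : u = (r + b - a) / 2 := by rw [hu, ← htr]; ring
    have e2 : v = (r + a - b) / 2 := by rw [hv, ← htr]; ring
    rw [e1, e2]; linear_combination hr2 / 4
  have key : 0 ≤ u * x ^ 2 - 2 * m * (x * y) + v * y ^ 2 := by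
    rcases hu0.eq_or_lt with h | h
    · have hm : m = 0 := by
        rw [← h, zero_mul, eq_comm] at huv
        exact pow_eq_zero_iff (two_ne_zero) |>.1 huv
      rw [← h, hm]; nlinarith [mul_nonneg hv0 (sq_nonneg y)]
    · refine nonneg_of_mul_nonneg_right (a := u) ?_ h
      have : u * (u * x ^ 2 - 2 * m * (x * y) + v * y ^ 2) = (u * x - m * y) ^ 2 := by
        linear_combination y ^ 2 * huv
      rw [this]; positivity
  rw [hu, hv] at key
  linarith

section MarkovModels

variable {A : Type} [Fintype A] [MeasurableSpace A] [DiscreteMeasurableSpace A] [Nonempty A]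
  {π : A → ℝ} {T : A → A → ℝ} {P : Measure (ℤ → A)} [IsProbabilityMeasure P]
  {H : Type} [NormedAddCommGroup H] [InnerProductSpace ℂ H]

/-- A memory that stores the last symbol `a` in a state `S a`, which the measurement turns into
`S x` with amplitude `√(T a x)`, is a quantum model of the Markov chain. -/
lemma IsMarkovLaw.isModel (hP : IsMarkovLaw π T P) (hπ : ∀ a, 0 ≤ π a) (hT : ∀ a b, 0 ≤ T a b)
    {S : A → H} (hS : ∀ a, ‖S a‖ = 1) {Q : QuantumTuple A H} [Unique Q.Index]
    (hQ : ∀ y, Q.encode y = S (y 0))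
    (hK : ∀ x k a, Q.kraus x k (S a) = (√(T a x) : ℂ) • S x)
    (hcompl : ∀ ψ : H, ∑ x, ‖Q.kraus x default ψ‖ ^ 2 = ‖ψ‖ ^ 2) : Q.IsModel P where
  norm_encode y := by rw [hQ, hS]
  measurable_encode := by
    simp only [hQ]
    exact ((StronglyMeasurable.of_discrete (f := fun a => ketBra (S a) (S a))).comp_measurable
      (measurable_pi_apply 0)).aestronglyMeasurable
  complete ψ := by
    rw [← hcompl, ← (Equiv.prodUnique A Q.Index).symm.hasSum_iff]
    exact hasSum_fintype _
  step := by
    filter_upwards [hP.nextProb_ae_eq hπ hT] with y hy x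
    have h := hasSum_unique fun k =>
      ketBra (Q.kraus x k (Q.encode y)) (Q.kraus x k (Q.encode y))
    convert h using 1
    have hx : extendPast y x 0 = x := rfl
    have hsq : ((T (y 0) x : ℝ) : ℂ) = (√(T (y 0) x) : ℂ) * (√(T (y 0) x) : ℂ) := by
      rw [← Complex.ofReal_mul, Real.mul_self_sqrt (hT _ _)]
    rw [hy, hQ, hQ, hK, hx]
    ext v
    simp only [smul_apply, ketBra_apply, inner_smul_left, Complex.conj_ofReal, smul_smul, hsq]
    congr 1
    ring

variable [CompleteSpace H]

lemma IsMarkovLaw.binEnt_le_entropy (hP : IsMarkovLaw π T P) (hπ : ∀ a, 0 ≤ π a)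
    (hT : ∀ a b, 0 ≤ T a b) {E : Type} [NormedAddCommGroup E] [InnerProductSpace ℝ E] {s : A → E}
    (hs : ∀ a b, ∑ x, √(T a x * T b x) ≤ ⟪s a, s b⟫_ℝ) {L : ℝ} (hL0 : 0 ≤ L) (hL1 : L ≤ 1)
    (hL : ∀ w : E, ∑ a, π a * ⟪s a, w⟫_ℝ ^ 2 ≤ L * ‖w‖ ^ 2) {Q : QuantumTuple A H}
    (hQ : Q.IsModel P) : ENNReal.ofReal (binEnt L) ≤ Q.entropy P := by
  refine binEnt_le_vonNeumannEntropy hQ.norm_encode hQ.measurable_encode hL1 ?_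
  refine integral_norm_inner_sq_le hQ.norm_encode hQ.measurable_encode
    (measurable_pi_apply 0 : Measurable fun y : ℕ → A => y 0) (s := s)
    (hQ.step.and (hP.nextProb_ae_eq hπ hT)) ?_ hL0 ?_
  · intro y y' hy hy'
    refine (hQ.norm_inner_encode_le hy.1 hy'.1).trans ((le_of_eq ?_).trans (hs _ _))
    exact Finset.sum_congr rfl fun x _ => by rw [hy.2, hy'.2]
  · simpa only [hP.pastLaw_real hπ] using hL

lemma QuantumTuple.IsOptimal.quantumComplexity_eq {Q : QuantumTuple A H} (hQ : Q.IsOptimal P) :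
    quantumComplexity P = Q.entropy P := by
  refine le_antisymm (sInf_le ⟨H, _, _, _, Q, hQ.1, rfl⟩) (le_sInf ?_)
  rintro _ ⟨K, _, _, _, Q', hQ', rfl⟩
  exact hQ.2 K Q' hQ'

/-- A model of a Markov chain whose memory states lie in a plane is optimal, if the overlaps of the
memory states attain the upper bound set by the Bhattacharyya coefficients of the next outputs. The
vectors `(s₁ a, s₂ a)` are real coordinates of the memory states in the plane. -/
theorem IsMarkovLaw.isOptimal_and_entropy_eq (hP : IsMarkovLaw π T P) (hπ : ∀ a, 0 ≤ π a)
    (hπ1 : ∑ a, π a = 1) (hT : ∀ a b, 0 ≤ T a b)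
    {S : A → H} (hS : ∀ a, ‖S a‖ = 1) {Q : QuantumTuple A H} (hQm : Q.IsModel P)
    (hQ : ∀ y, Q.encode y = S (y 0))
    {V : Submodule ℂ H} [FiniteDimensional ℂ V] (hV : Module.finrank ℂ V ≤ 2)
    (hSV : ∀ a, S a ∈ V) {s₁ s₂ : A → ℝ} (hs1 : ∀ a, s₁ a ^ 2 + s₂ a ^ 2 = 1)
    (hs : ∀ a b, ∑ x, √(T a x * T b x) = s₁ a * s₁ b + s₂ a * s₂ b)
    (hG : ∀ a b, ⟪S a, S b⟫_ℂ = ((s₁ a * s₁ b + s₂ a * s₂ b : ℝ) : ℂ)) {D : ℝ} (hD0 : 0 ≤ D)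
    (hD : D = (∑ a, π a * s₁ a ^ 2) * (∑ a, π a * s₂ a ^ 2) - (∑ a, π a * (s₁ a * s₂ a)) ^ 2) :
    Q.IsOptimal P ∧ Q.entropy P = ENNReal.ofReal (binEnt ((1 + √(1 - 4 * D)) / 2)) := by
  have htr : (∑ a, π a * s₁ a ^ 2) + (∑ a, π a * s₂ a ^ 2) = 1 := by
    rw [← Finset.sum_add_distrib, ← hπ1]
    exact Finset.sum_congr rfl fun a _ => by rw [← mul_add, hs1, mul_one]
  have hent : Q.entropy P = ENNReal.ofReal (binEnt ((1 + √(1 - 4 * D)) / 2)) := by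
    refine vonNeumannEntropy_eq_binEnt (measurable_pi_apply 0 : Measurable fun y : ℕ → A => y 0)
      hS hQ hQm.measurable_encode hV hSV ?_
    simp only [hP.pastLaw_real hπ, hG, Complex.norm_real, Real.norm_eq_abs, sq_abs]
    have e : ∀ i k, π i * (π k * (s₁ i * s₁ k + s₂ i * s₂ k) ^ 2) =
        π i * s₁ i ^ 2 * (π k * s₁ k ^ 2) + π i * s₂ i ^ 2 * (π k * s₂ k ^ 2) +
          2 * (π i * (s₁ i * s₂ i) * (π k * (s₁ k * s₂ k))) := fun i k => by ring
    simp only [e, Finset.sum_add_distrib, ← Finset.mul_sum, ← Finset.sum_mul]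
    rw [hD]
    linear_combination ((∑ a, π a * s₁ a ^ 2) + (∑ a, π a * s₂ a ^ 2) + 1) * htr
  refine ⟨⟨hQm, fun K _ _ _ Q' hQ' => ?_⟩, hent⟩
  rw [hent]
  have hr1 : √(1 - 4 * D) ≤ 1 := Real.sqrt_le_one.2 (by linarith)
  refine hP.binEnt_le_entropy hπ hT (s := fun a => !₂[s₁ a, s₂ a]) (fun a b => ?_)
    (by positivity) (by linarith) (fun w => ?_) hQ'
  · rw [hs]
    simp [PiLp.inner_apply, mul_comm]
  · have h := quadratic_form_le htr hD (w 0) (w 1)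
    rw [EuclideanSpace.norm_sq_eq, Fin.sum_univ_two, Real.norm_eq_abs, Real.norm_eq_abs, sq_abs,
      sq_abs]
    refine (le_of_eq ?_).trans h
    simp only [PiLp.inner_apply, Fin.sum_univ_two, RCLike.inner_apply, conj_trivial]
    simp only [Finset.sum_mul, Finset.mul_sum, ← Finset.sum_add_distrib]
    refine Finset.sum_congr rfl fun a _ => ?_
    simp
    ring

end MarkovModels

/-! ### Time reversal and construction of Markov chains -/

lemma prod_transition_reverse {A : Type} {π : A → ℝ} {T T' : A → A → ℝ}
    (h : ∀ i j, π i * T' i j = π j * T j i) (v : ℕ → A) (n : ℕ) :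
    π (v 0) * ∏ i ∈ Finset.range n, T' (v i) (v (i + 1)) =
      π (v n) * ∏ i ∈ Finset.range n, T (v (i + 1)) (v i) := by
  induction n with
  | zero => simp
  | succ n ih =>
    rw [Finset.prod_range_succ, Finset.prod_range_succ, ← mul_assoc, ih]
    linear_combination (∏ i ∈ Finset.range n, T (v (i + 1)) (v i)) * h (v n) (v (n + 1))

section Reversal

variable {A : Type} [MeasurableSpace A]
  {π : A → ℝ} {T T' : A → A → ℝ} {P : Measure (ℤ → A)} [Fintype A] [DiscreteMeasurableSpace A]

/-- The time reversal of a Markov chain is the Markov chain whose transition matrix `T'` is given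
by Bayes' rule. -/
lemma IsMarkovLaw.timeReversal (hP : IsMarkovLaw π T P) (h : ∀ i j, π i * T' i j = π j * T j i) :
    IsMarkovLaw π T' (timeReversal P) := by
  intro t n w
  rw [_root_.timeReversal, Measure.map_apply measurable_reversePath (measurableSet_window _ _ _)]
  have e : reversePath ⁻¹' {x : ℤ → A | ∀ i ≤ n, x (t + (i : ℕ)) = w i} =
      {x | ∀ i ≤ n, x (-(t + n + 1) + (i : ℕ)) = w (n - i)} := by
    ext x
    refine ⟨fun hx i hi => ?_, fun hx i hi => ?_⟩
    · rw [← hx (n - i) (by omega), reversePath]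
      congr 1; push_cast [hi]; ring
    · have := hx (n - i) (by omega)
      rw [show n - (n - i) = i by omega] at this
      rw [← this, reversePath]
      congr 1; push_cast [hi]; ring
  rw [e, hP, prod_transition_reverse h, ← Finset.prod_range_reflect]
  congr 2
  refine Finset.prod_congr rfl fun i hi => ?_
  have := Finset.mem_range.1 hi
  rw [show n - (n - 1 - i + 1) = i by omega, show n - (n - 1 - i) = i + 1 by omega]

end Reversal

section Walk

variable {A : Type}

/-- The path obtained by applying the maps `g 0, g 1, …` to the initial point `a`. -/
def walk (a : A) (g : ℕ → A → A) : ℕ → A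
  | 0 => a
  | n + 1 => g n (walk a g n)

lemma walk_eq_iff (a : A) (g : ℕ → A → A) (v : ℕ → A) (N : ℕ) :
    (∀ n ≤ N, walk a g n = v n) ↔ a = v 0 ∧ ∀ n < N, g n (v n) = v (n + 1) := by
  refine ⟨fun h => ⟨h 0 (Nat.zero_le _), fun n hn => ?_⟩, fun ⟨h0, h⟩ n => ?_⟩
  · rw [← h n hn.le, ← h (n + 1) hn]; rfl
  · induction n with
    | zero => exact fun _ => h0
    | succ n ih =>
      intro hn
      rw [← h n hn, ← ih (by omega)]; rfl

variable [Fintype A] [MeasurableSpace A]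

/-- The probability measure on a finite set with weights `p`. -/
noncomputable def weightMeasure (p : A → ℝ) : Measure A :=
  ∑ a, ENNReal.ofReal (p a) • Measure.dirac a

lemma isProbabilityMeasure_weightMeasure {p : A → ℝ} (h0 : ∀ a, 0 ≤ p a) (h1 : ∑ a, p a = 1) :
    IsProbabilityMeasure (weightMeasure p) := by
  constructor
  simp [weightMeasure, ← ENNReal.ofReal_sum_of_nonneg fun a _ => h0 a, h1]

variable [DiscreteMeasurableSpace A]

lemma weightMeasure_singleton (p : A → ℝ) (a : A) :
    weightMeasure p {a} = ENNReal.ofReal (p a) := by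
  classical
  simp [weightMeasure, Set.indicator_apply]

end Walk

section Existence

variable {A : Type} [Fintype A] [MeasurableSpace A] [DiscreteMeasurableSpace A]
  {π : A → ℝ} {T : A → A → ℝ} {P : Measure (ℤ → A)}

lemma measure_eq_sum_inter (P : Measure (ℤ → A)) (S : Set (ℤ → A)) (t : ℤ) :
    P S = ∑ a, P ({x | x t = a} ∩ S) := by
  have hm : Measurable fun x : ℤ → A => x t := measurable_pi_apply t
  have h := sum_measure_preimage_singleton (μ := P.restrict S) Finset.univ
    (f := fun x : ℤ → A => x t) fun a _ => hm (measurableSet_singleton a)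
  rw [Finset.coe_univ, Set.preimage_univ, Measure.restrict_apply_univ] at h
  rw [← h]
  exact Finset.sum_congr rfl fun a _ => Measure.restrict_apply (hm (measurableSet_singleton a))

/-- It suffices to know the law of a Markov chain on windows that exhaust the time axis. -/
lemma isMarkovLaw_of_symmetric_windows (hπ : ∀ a, 0 ≤ π a) (hT : ∀ a b, 0 ≤ T a b)
    (hT1 : ∀ a, ∑ b, T a b = 1) (hπT : ∀ b, ∑ a, π a * T a b = π b)
    (h : ∀ (N : ℕ) (w : ℕ → A), P {x | ∀ i ≤ N + N, x (-N + (i : ℕ)) = w i} =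
      ENNReal.ofReal (π (w 0) * ∏ i ∈ Finset.range (N + N), T (w i) (w (i + 1)))) :
    IsMarkovLaw π T P := by
  classical
  set W : ℤ → ℕ → Prop := fun t n => ∀ w : ℕ → A, P {x | ∀ i ≤ n, x (t + (i : ℕ)) = w i} =
    ENNReal.ofReal (π (w 0) * ∏ i ∈ Finset.range n, T (w i) (w (i + 1))) with hW
  have hprod : ∀ (n : ℕ) (w : ℕ → A), 0 ≤ ∏ i ∈ Finset.range n, T (w i) (w (i + 1)) :=
    fun n w => Finset.prod_nonneg fun _ _ => hT _ _
  have hright : ∀ t n, W t (n + 1) → W t n := by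
    intro t n hw w
    rw [measure_eq_sum_inter P _ (t + (n + 1 : ℕ))]
    have e : ∀ a, {x : ℤ → A | x (t + (n + 1 : ℕ)) = a} ∩ {x | ∀ i ≤ n, x (t + (i : ℕ)) = w i} =
        {x | ∀ i ≤ n + 1, x (t + (i : ℕ)) = Function.update w (n + 1) a i} := by
      intro a
      ext x
      refine ⟨fun ⟨h1, h2⟩ i hi => ?_, fun hx => ⟨?_, fun i hi => ?_⟩⟩
      · rcases Nat.le_succ_iff.1 hi with h | rfl
        · rw [Function.update_of_ne (by omega)]; exact h2 i h
        · rw [Function.update_self]; exact h1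
      · have := hx (n + 1) le_rfl
        rwa [Function.update_self] at this
      · have := hx i (by omega)
        rwa [Function.update_of_ne (by omega)] at this
    have e2 : ∀ a, P {x | ∀ i ≤ n + 1, x (t + (i : ℕ)) = Function.update w (n + 1) a i} =
        ENNReal.ofReal (π (w 0) * (∏ i ∈ Finset.range n, T (w i) (w (i + 1))) * T (w n) a) := by
      intro a
      rw [hw, Finset.prod_range_succ, Function.update_of_ne (by omega),
        Function.update_of_ne (by omega : n ≠ n + 1), Function.update_self, ← mul_assoc]
      congr 3
      refine Finset.prod_congr rfl fun i hi => ?_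
      have := Finset.mem_range.1 hi
      rw [Function.update_of_ne (by omega), Function.update_of_ne (by omega)]
    simp only [e, e2]
    rw [← ENNReal.ofReal_sum_of_nonneg fun a _ => mul_nonneg (mul_nonneg (hπ _) (hprod _ _))
      (hT _ _), ← Finset.mul_sum, hT1, mul_one]
  have hleft : ∀ t n, W t (n + 1) → W (t + 1) n := by
    intro t n hw w
    rw [measure_eq_sum_inter P _ t]
    have e : ∀ a, {x : ℤ → A | x t = a} ∩ {x | ∀ i ≤ n, x (t + 1 + (i : ℕ)) = w i} =
        {x | ∀ i ≤ n + 1, x (t + (i : ℕ)) = (fun i => Nat.casesOn i a w : ℕ → A) i} := by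
      intro a
      ext x
      refine ⟨fun ⟨h1, h2⟩ i hi => ?_, fun hx => ⟨?_, fun i hi => ?_⟩⟩
      · rcases i with _ | i
        · simpa using h1
        · have := h2 i (by omega)
          simp only [← this]
          congr 1; push_cast; ring
      · simpa using hx 0 (by omega)
      · have := hx (i + 1) (by omega)
        simp only at this
        rw [← this]
        congr 1; push_cast; ring
    have e2 : ∀ a, P {x | ∀ i ≤ n + 1, x (t + (i : ℕ)) = (fun i => Nat.casesOn i a w : ℕ → A) i} =
        ENNReal.ofReal (π a * T a (w 0) * ∏ i ∈ Finset.range n, T (w i) (w (i + 1))) := by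
      intro a
      rw [hw, Finset.prod_range_succ', mul_assoc, mul_comm (T a (w 0))]
      rfl
    simp only [e, e2]
    rw [← ENNReal.ofReal_sum_of_nonneg fun a _ => mul_nonneg (mul_nonneg (hπ _) (hT _ _))
      (hprod _ _), ← Finset.sum_mul, hπT]
  have hright' : ∀ (k n : ℕ) (t : ℤ), W t (n + k) → W t n := by
    intro k
    induction k with
    | zero => exact fun n t h => h
    | succ k ih => exact fun n t h => ih n t (hright t _ h)
  have hleft' : ∀ (k n : ℕ) (t : ℤ), W t (n + k) → W (t + k) n := by
    intro k
    induction k with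
    | zero => intro n t h; simpa using h
    | succ k ih =>
      intro n t h
      have := ih n (t + 1) (hleft t _ h)
      rwa [show t + 1 + (k : ℤ) = t + (k + 1 : ℕ) by push_cast; ring] at this
  intro t n
  set N : ℕ := t.natAbs + n with hN
  have h0 : W (-N) (N + N) := h N
  obtain ⟨k, hk⟩ : ∃ k : ℕ, t = -N + k := ⟨(t + N).toNat, by omega⟩
  obtain ⟨j, hj⟩ : ∃ j : ℕ, N + N = n + j + k := ⟨N + N - n - k, by omega⟩
  rw [hj] at h0
  have h1 := hright' j n _ (hleft' k (n + j) _ h0)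
  rw [← hk] at h1
  exact h1

lemma measurable_walk (n : ℕ) : Measurable fun z : A × (ℕ → A → A) => walk z.1 z.2 n := by
  induction n with
  | zero => exact measurable_fst
  | succ n ih =>
    have hev : Measurable fun z : A × (A → A) => z.2 z.1 :=
      measurable_from_prod_countable_right fun a => measurable_pi_apply a
    exact hev.comp (ih.prodMk ((measurable_pi_apply n).comp measurable_snd))

/-- The two-sided path through `z.1` at time zero, with steps `z.2.1` into the future and `z.2.2`
into the past. -/
def twoSidedWalk (z : A × (ℕ → A → A) × (ℕ → A → A)) : ℤ → A
  | .ofNat n => walk z.1 z.2.1 n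
  | .negSucc n => walk z.1 z.2.2 (n + 1)

lemma measurable_twoSidedWalk :
    Measurable (twoSidedWalk : A × (ℕ → A → A) × (ℕ → A → A) → ℤ → A) := by
  refine measurable_pi_lambda _ fun t => ?_
  rcases t with n | n
  · exact (measurable_walk n).comp (measurable_fst.prodMk measurable_snd.fst)
  · exact (measurable_walk (n + 1)).comp (measurable_fst.prodMk measurable_snd.snd)

/-- A reversible transition matrix has a stationary two-sided Markov chain: run the chain from its
stationary state at time zero independently in both directions of time. -/
theorem exists_isMarkovLaw (hπ : ∀ a, 0 ≤ π a) (hπ1 : ∑ a, π a = 1) (hT : ∀ a b, 0 ≤ T a b)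
    (hT1 : ∀ a, ∑ b, T a b = 1) (hrev : ∀ a b, π a * T a b = π b * T b a) :
    ∃ P : Measure (ℤ → A), IsProbabilityMeasure P ∧ IsMarkovLaw π T P := by
  have := isProbabilityMeasure_weightMeasure hπ hπ1
  have := fun a => isProbabilityMeasure_weightMeasure (hT a) (hT1 a)
  set ρ : Measure (A → A) := Measure.pi fun a => weightMeasure (T a) with hρ
  set R : Measure (ℕ → A → A) := Measure.infinitePi fun _ => ρ with hR
  set M := (weightMeasure π).prod (R.prod R) with hM
  have hρT : ∀ a b, ρ {f | f a = b} = ENNReal.ofReal (T a b) := by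
    intro a b
    rw [← weightMeasure_singleton (T a) b]
    exact (measurePreserving_eval (fun a => weightMeasure (T a)) a).measure_preimage
      (measurableSet_singleton b).nullMeasurableSet
  have hRT : ∀ (N : ℕ) (v : ℕ → A), R {g | ∀ n < N, g n (v n) = v (n + 1)} =
      ENNReal.ofReal (∏ n ∈ Finset.range N, T (v n) (v (n + 1))) := by
    intro N v
    have e : {g : ℕ → A → A | ∀ n < N, g n (v n) = v (n + 1)} =
        (Finset.range N : Set ℕ).pi fun n => {f : A → A | f (v n) = v (n + 1)} := by
      ext g; simp
    have hmeas : ∀ n ∈ Finset.range N, MeasurableSet {f : A → A | f (v n) = v (n + 1)} :=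
      fun n _ => (measurable_pi_apply (v n) : Measurable fun f : A → A => f (v n))
        (measurableSet_singleton (v (n + 1)))
    rw [e, hR, Measure.infinitePi_pi _ hmeas, ENNReal.ofReal_prod_of_nonneg fun n _ => hT _ _]
    exact Finset.prod_congr rfl fun n _ => hρT _ _
  refine ⟨M.map twoSidedWalk, Measure.isProbabilityMeasure_map
    measurable_twoSidedWalk.aemeasurable, ?_⟩
  have hπT : ∀ b, ∑ a, π a * T a b = π b := fun b => by
    simp only [hrev _ b]; rw [← Finset.mul_sum, hT1, mul_one]
  refine isMarkovLaw_of_symmetric_windows hπ hT hT1 hπT fun N w => ?_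
  rw [Measure.map_apply measurable_twoSidedWalk (measurableSet_window _ _ _)]
  set vf : ℕ → A := fun n => w (N + n) with hvf
  set vb : ℕ → A := fun n => w (N - n) with hvb
  have e : twoSidedWalk ⁻¹' {x : ℤ → A | ∀ i ≤ N + N, x (-N + (i : ℕ)) = w i} =
      {w N} ×ˢ ({g | ∀ n < N, g n (vf n) = vf (n + 1)} ×ˢ
        {g | ∀ n < N, g n (vb n) = vb (n + 1)}) := by
    ext ⟨a, g, g'⟩
    have hf := walk_eq_iff a g vf N
    have hb := walk_eq_iff a g' vb N
    have hf0 : vf 0 = w N := rfl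
    have hb0 : vb 0 = w N := rfl
    rw [hf0] at hf
    rw [hb0] at hb
    have key : (∀ i ≤ N + N, twoSidedWalk (a, g, g') (-N + (i : ℕ)) = w i) ↔
        (∀ n ≤ N, walk a g n = vf n) ∧ (∀ n ≤ N, walk a g' n = vb n) := by
      refine ⟨fun h => ⟨fun n hn => ?_, fun n hn => ?_⟩, fun ⟨h1, h2⟩ i hi => ?_⟩
      · have := h (N + n) (by omega)
        rwa [show (-N + (N + n : ℕ) : ℤ) = Int.ofNat n by simp] at this
      · have := h (N - n) (by omega)
        rcases n with _ | n
        · rwa [show (-N + (N - 0 : ℕ) : ℤ) = Int.ofNat 0 by simp] at this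
        · rwa [show (-N + (N - (n + 1) : ℕ) : ℤ) = Int.negSucc n by
            rw [Int.negSucc_eq]; omega] at this
      · rcases le_or_gt N i with h | h
        · rw [show (-N + i : ℤ) = Int.ofNat (i - N) by simp; omega]
          refine (h1 (i - N) (by omega)).trans ?_
          rw [hvf]; simp only; congr 1; omega
        · rw [show (-N + i : ℤ) = Int.negSucc (N - i - 1) by rw [Int.negSucc_eq]; omega]
          refine (h2 (N - i - 1 + 1) (by omega)).trans ?_
          rw [hvb]; simp only; congr 1; omega
    change (∀ i ≤ N + N, twoSidedWalk (a, g, g') (-N + (i : ℕ)) = w i) ↔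
      a = w N ∧ (∀ n < N, g n (vf n) = vf (n + 1)) ∧ (∀ n < N, g' n (vb n) = vb (n + 1))
    rw [key, hf, hb]
    tauto
  have hprod : ∀ v : ℕ → A, 0 ≤ ∏ n ∈ Finset.range N, T (v n) (v (n + 1)) :=
    fun v => Finset.prod_nonneg fun _ _ => hT _ _
  rw [e, hM, Measure.prod_prod, Measure.prod_prod, weightMeasure_singleton, hRT, hRT,
    ← ENNReal.ofReal_mul (hprod _), ← ENNReal.ofReal_mul (hπ _)]
  congr 1
  have hback := prod_transition_reverse hrev vb N
  rw [← Finset.prod_range_reflect (fun i => T (vb (i + 1)) (vb i))] at hback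
  have e2 : ∏ i ∈ Finset.range N, T (vb (N - 1 - i + 1)) (vb (N - 1 - i)) =
      ∏ i ∈ Finset.range N, T (w i) (w (i + 1)) := by
    refine Finset.prod_congr rfl fun i hi => ?_
    have := Finset.mem_range.1 hi
    simp only [hvb]
    rw [show N - (N - 1 - i + 1) = i by omega, show N - (N - 1 - i) = i + 1 by omega]
  rw [e2] at hback
  have hb0 : vb 0 = w N := rfl
  have hbN : vb N = w 0 := by simp [hvb]
  rw [hb0, hbN] at hback
  rw [Finset.prod_range_add]
  calc _ = (∏ n ∈ Finset.range N, T (vf n) (vf (n + 1))) *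
        (π (w N) * ∏ n ∈ Finset.range N, T (vb n) (vb (n + 1))) := by ring
    _ = _ := by rw [hback]; simp only [hvf, add_assoc]; ring

end Existence

/-! ### The law of the heralding coin -/

section Herald

variable {p q : ℝ}

/-- The symbol of the heralding coin, as a function of the previous and the current state of the
perturbed coin. -/
def heraldSymbol (a b : Fin 2) : Fin 3 := if b = 1 then 1 else if a = 1 then 2 else 0

/-- The state of the perturbed coin underlying a symbol of the heralding coin. -/
def coinState : Fin 3 → Fin 2 := ![0, 1, 0]

/-- Transition probabilities of the heralding coin. -/
def heraldTransition (p q : ℝ) : Fin 3 → Fin 3 → ℝ :=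
  ![![1 - p, p, 0], ![0, 1 - q, q], ![1 - p, p, 0]]

/-- Transition probabilities of the time-reversed heralding coin. -/
def reverseHeraldTransition (p q : ℝ) : Fin 3 → Fin 3 → ℝ :=
  ![![1 - p, 0, p], ![q * (1 - p), 1 - q, p * q], ![0, 1, 0]]

/-- The stationary distribution of the heralding coin, and of its time reversal. -/
noncomputable def heraldStationary (p q : ℝ) : Fin 3 → ℝ :=
  ![q * (1 - p) / (p + q), p / (p + q), p * q / (p + q)]

lemma coinState_heraldSymbol (a b : Fin 2) : coinState (heraldSymbol a b) = b := by
  fin_cases a <;> fin_cases b <;> rfl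

lemma heraldTransition_eq (i j : Fin 3) : heraldTransition p q i j =
    if heraldSymbol (coinState i) (coinState j) = j
      then coinTransition p q (coinState i) (coinState j) else 0 := by
  fin_cases i <;> fin_cases j <;>
    simp [heraldTransition, heraldSymbol, coinState, coinTransition]

lemma heraldStationary_eq (h : p + q ≠ 0) (j : Fin 3) : heraldStationary p q j =
    ∑ a, if heraldSymbol a (coinState j) = j
      then coinStationary p q a * coinTransition p q a (coinState j) else 0 := by
  fin_cases j <;>
    simp [heraldStationary, heraldSymbol, coinState, coinTransition, coinStationary,
      Fin.sum_univ_two] <;> field_simp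
  ring

lemma measurable_herald : Measurable herald := by
  refine measurable_pi_lambda _ fun t => ?_
  have h : Measurable fun b : ℤ → Fin 2 => (b (t - 1), b t) :=
    (measurable_pi_apply _).prodMk (measurable_pi_apply _)
  exact (measurable_of_countable fun z : Fin 2 × Fin 2 => heraldSymbol z.1 z.2).comp h

lemma coinTransition_nonneg (hp0 : 0 ≤ p) (hp1 : p ≤ 1) (hq0 : 0 ≤ q) (hq1 : q ≤ 1)
    (a b : Fin 2) : 0 ≤ coinTransition p q a b := by
  fin_cases a <;> fin_cases b <;> simp [coinTransition] <;> linarith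

lemma coinStationary_nonneg (hp0 : 0 ≤ p) (hq0 : 0 ≤ q) (a : Fin 2) :
    0 ≤ coinStationary p q a := by
  fin_cases a <;> simp [coinStationary] <;> positivity

/-- The heralding coin is a Markov chain: the previous symbol determines the previous state of the
perturbed coin. -/
lemma IsPerturbedCoin.isMarkovLaw_heraldingCoin (hp0 : 0 ≤ p) (hp1 : p ≤ 1) (hq0 : 0 ≤ q)
    (hq1 : q ≤ 1) (hpq : 0 < p + q) {ν : Measure (ℤ → Fin 2)} (hν : IsPerturbedCoin p q ν) :
    IsMarkovLaw (heraldStationary p q) (heraldTransition p q) (heraldingCoin ν) := by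
  intro t n w
  rw [heraldingCoin, Measure.map_apply measurable_herald (measurableSet_window _ _ _),
    measure_eq_sum_inter ν _ (t - 1)]
  set u : ℕ → Fin 2 := fun i => coinState (w i) with hu
  set v : Fin 2 → ℕ → Fin 2 := fun a i => Nat.casesOn i a u with hv
  have hT := coinTransition_nonneg hp0 hp1 hq0 hq1
  have hπ := coinStationary_nonneg hp0 hq0 (p := p)
  -- a window of the heralding coin, with the coin state preceding it, is a window of the coin
  have hsplit : ∀ a, ν ({b | b (t - 1) = a} ∩
      herald ⁻¹' {x | ∀ i ≤ n, x (t + (i : ℕ)) = w i}) =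
      ENNReal.ofReal ((if heraldSymbol a (u 0) = w 0 then
        coinStationary p q a * coinTransition p q a (u 0) else 0) *
          ∏ i ∈ Finset.range n, heraldTransition p q (w i) (w (i + 1))) := by
    intro a
    have hmem : ∀ b : ℤ → Fin 2, b ∈ {b | b (t - 1) = a} ∩
        herald ⁻¹' {x | ∀ i ≤ n, x (t + (i : ℕ)) = w i} ↔
        (∀ i ≤ n + 1, b (t - 1 + (i : ℕ)) = v a i) ∧
          ∀ i ≤ n, heraldSymbol (v a i) (v a (i + 1)) = w i := by
      intro b
      have hh : ∀ i : ℕ, herald b (t + i) =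
          heraldSymbol (b (t - 1 + i)) (b (t - 1 + (i + 1 : ℕ))) := by
        intro i
        rw [show t - 1 + (i : ℤ) = t + i - 1 by ring,
          show t - 1 + ((i + 1 : ℕ) : ℤ) = t + i by push_cast; ring]
        rfl
      refine ⟨fun ⟨h1, h2⟩ => ?_, fun ⟨h1, h2⟩ => ⟨?_, fun i hi => ?_⟩⟩
      · have h3 : ∀ i ≤ n + 1, b (t - 1 + (i : ℕ)) = v a i := by
          intro i hi
          rcases i with _ | i
          · simpa [hv] using h1
          · have := h2 i (by omega)
            rw [hh] at this
            change _ = coinState (w i)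
            rw [← this, coinState_heraldSymbol]
        refine ⟨h3, fun i hi => ?_⟩
        rw [← h3 i (by omega), ← h3 (i + 1) (by omega), ← hh]
        exact h2 i hi
      · simpa [hv] using h1 0 (by omega)
      · rw [hh, h1 i (by omega), h1 (i + 1) (by omega)]
        exact h2 i hi
    by_cases hc : ∀ i ≤ n, heraldSymbol (v a i) (v a (i + 1)) = w i
    · have e : {b | b (t - 1) = a} ∩ herald ⁻¹' {x | ∀ i ≤ n, x (t + (i : ℕ)) = w i} =
          {b : ℤ → Fin 2 | ∀ i ≤ n + 1, b (t - 1 + (i : ℕ)) = v a i} := by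
        ext b
        rw [hmem]
        exact and_iff_left hc
      have hc0 : heraldSymbol a (u 0) = w 0 := hc 0 (by omega)
      rw [e, hν, Finset.prod_range_succ', if_pos hc0]
      have e2 : ∏ i ∈ Finset.range n, heraldTransition p q (w i) (w (i + 1)) =
          ∏ i ∈ Finset.range n, coinTransition p q (v a (i + 1)) (v a (i + 1 + 1)) := by
        refine Finset.prod_congr rfl fun i hi => ?_
        rw [heraldTransition_eq, if_pos (hc (i + 1) (by simpa using hi))]
      rw [e2]
      congr 1
      change coinStationary p q a * (_ * coinTransition p q a (u 0)) = _
      ring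
    · have e : {b | b (t - 1) = a} ∩ herald ⁻¹' {x | ∀ i ≤ n, x (t + (i : ℕ)) = w i} = ∅ := by
        ext b
        rw [hmem]
        simp [hc]
      rw [e, measure_empty, eq_comm, ENNReal.ofReal_eq_zero]
      push Not at hc
      obtain ⟨i, hi, hne⟩ := hc
      refine le_of_eq ?_
      rcases i with _ | i
      · have hne0 : heraldSymbol a (u 0) ≠ w 0 := hne
        rw [if_neg hne0, zero_mul]
      · rw [Finset.prod_eq_zero (Finset.mem_range.2 hi), mul_zero]
        rw [heraldTransition_eq, if_neg hne]
  simp only [hsplit]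
  have hprod : 0 ≤ ∏ i ∈ Finset.range n, heraldTransition p q (w i) (w (i + 1)) := by
    refine Finset.prod_nonneg fun i _ => ?_
    rw [heraldTransition_eq]
    split_ifs
    exacts [hT _ _, le_rfl]
  rw [← ENNReal.ofReal_sum_of_nonneg, ← Finset.sum_mul, ← heraldStationary_eq hpq.ne']
  intro a _
  refine mul_nonneg ?_ hprod
  split_ifs
  exacts [mul_nonneg (hπ _) (hT _ _), le_rfl]

lemma heraldTransition_nonneg (hp0 : 0 ≤ p) (hp1 : p ≤ 1) (hq0 : 0 ≤ q) (hq1 : q ≤ 1)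
    (a b : Fin 3) : 0 ≤ heraldTransition p q a b := by
  rw [heraldTransition_eq]
  split_ifs
  exacts [coinTransition_nonneg hp0 hp1 hq0 hq1 _ _, le_rfl]

lemma reverseHeraldTransition_nonneg (hp0 : 0 ≤ p) (hp1 : p ≤ 1) (hq0 : 0 ≤ q) (hq1 : q ≤ 1)
    (a b : Fin 3) : 0 ≤ reverseHeraldTransition p q a b := by
  have : 0 ≤ 1 - p := by linarith
  have : 0 ≤ 1 - q := by linarith
  fin_cases a <;> fin_cases b <;> simp [reverseHeraldTransition] <;> first | linarith | positivity

lemma heraldStationary_nonneg (hp0 : 0 ≤ p) (hp1 : p ≤ 1) (hq0 : 0 ≤ q) (a : Fin 3) :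
    0 ≤ heraldStationary p q a := by
  have : 0 ≤ 1 - p := by linarith
  fin_cases a <;> simp [heraldStationary] <;> positivity

lemma sum_heraldStationary (h : p + q ≠ 0) : ∑ a, heraldStationary p q a = 1 := by
  simp [heraldStationary, Fin.sum_univ_three]
  field_simp
  ring

lemma heraldStationary_mul_reverse (i j : Fin 3) :
    heraldStationary p q i * reverseHeraldTransition p q i j =
      heraldStationary p q j * heraldTransition p q j i := by
  fin_cases i <;> fin_cases j <;>
    simp [heraldStationary, reverseHeraldTransition, heraldTransition] <;> ring

/-- The perturbed coin exists: it is reversible, as any two-state Markov chain. -/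
lemma exists_isPerturbedCoin (hp0 : 0 ≤ p) (hp1 : p ≤ 1) (hq0 : 0 ≤ q) (hq1 : q ≤ 1)
    (hpq : 0 < p + q) :
    ∃ ν : Measure (ℤ → Fin 2), IsProbabilityMeasure ν ∧ IsPerturbedCoin p q ν := by
  refine exists_isMarkovLaw (coinStationary_nonneg hp0 hq0) ?_
    (coinTransition_nonneg hp0 hp1 hq0 hq1) ?_ ?_
  · simp only [coinStationary, Fin.sum_univ_two, Matrix.cons_val_zero, Matrix.cons_val_one]
    field_simp
    ring
  · intro a
    fin_cases a <;> simp [coinTransition]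
  · intro a b
    fin_cases a <;> fin_cases b <;> simp [coinTransition, coinStationary] <;> ring

instance isProbabilityMeasure_heraldingCoin (ν : Measure (ℤ → Fin 2)) [IsProbabilityMeasure ν] :
    IsProbabilityMeasure (heraldingCoin ν) :=
  Measure.isProbabilityMeasure_map measurable_herald.aemeasurable

instance isProbabilityMeasure_timeReversal {A : Type} [MeasurableSpace A] (P : Measure (ℤ → A))
    [IsProbabilityMeasure P] : IsProbabilityMeasure (timeReversal P) :=
  Measure.isProbabilityMeasure_map measurable_reversePath.aemeasurable

end Herald

/-! ### Statistical complexity of the heralding coin -/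

section Classical

variable {p q : ℝ} {ν : Measure (ℤ → Fin 2)} [IsProbabilityMeasure ν]

/-- The causal states of the heralding coin are the two states of the perturbed coin. -/
lemma classicalComplexity_heraldingCoin (hp0 : 0 ≤ p) (hp1 : p ≤ 1) (hq0 : 0 ≤ q)
    (hq1 : q ≤ 1) (hpq : 0 < p + q) (hν : IsPerturbedCoin p q ν) :
    classicalComplexity (heraldingCoin ν) = ENNReal.ofReal (binEnt (p / (p + q))) := by
  have hP := hν.isMarkovLaw_heraldingCoin hp0 hp1 hq0 hq1 hpq
  rw [hP.classicalComplexity_eq (heraldStationary_nonneg hp0 hp1 hq0)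
    (heraldTransition_nonneg hp0 hp1 hq0 hq1) coinState]
  · congr 1
    have e0 : (Finset.univ.filter fun a : Fin 3 => coinState a = 0) = {0, 2} := by decide
    have e1 : (Finset.univ.filter fun a : Fin 3 => coinState a = 1) = {1} := by decide
    rw [Fin.sum_univ_two, e0, e1, Finset.sum_pair (by decide), Finset.sum_singleton, binEnt,
      add_comm]
    congr 2
    simp [heraldStationary]
    field_simp
    ring
  · have h01 : ∀ a, coinState a ≠ 1 → heraldStationary p q a ≠ 0 →
        heraldStationary p q 1 ≠ 0 → heraldTransition p q a ≠ heraldTransition p q 1 := by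
      intro a ha h h1 he
      have hq : q ≠ 0 := by
        rintro rfl
        fin_cases a
        · simp [heraldStationary] at h
        · exact ha rfl
        · simp [heraldStationary] at h
      have := congrFun he 2
      fin_cases a
      · exact hq (by simpa [heraldTransition] using this.symm)
      · exact ha rfl
      · exact hq (by simpa [heraldTransition] using this.symm)
    have hst : ∀ a : Fin 3, a ≠ 1 → coinState a ≠ 1 := by decide
    intro a a' ha ha'
    by_cases h1 : a = 1 <;> by_cases h2 : a' = 1
    · simp [h1, h2]
    · subst h1
      exact iff_of_false (h01 a' (hst a' h2) ha' ha).symm (hst a' h2).symm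
    · subst h2
      exact iff_of_false (h01 a (hst a h1) ha ha') (hst a h1)
    · have e : ∀ a : Fin 3, a ≠ 1 → a = 0 ∨ a = 2 := by decide
      rcases e a h1 with rfl | rfl <;> rcases e a' h2 with rfl | rfl <;>
        simp [heraldTransition, coinState]

/-- The time-reversed heralding coin has one causal state for each symbol. -/
lemma classicalComplexity_timeReversal_heraldingCoin (hp0 : 0 < p) (hp1 : p < 1) (hq0 : 0 < q)
    (hq1 : q < 1) (hν : IsPerturbedCoin p q ν) :
    classicalComplexity (timeReversal (heraldingCoin ν)) =
      ENNReal.ofReal (∑ a, eta (heraldStationary p q a)) := by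
  have hP := (hν.isMarkovLaw_heraldingCoin hp0.le hp1.le hq0.le hq1.le
    (by positivity)).timeReversal heraldStationary_mul_reverse
  rw [hP.classicalComplexity_eq (heraldStationary_nonneg hp0.le hp1.le hq0.le)
    (reverseHeraldTransition_nonneg hp0.le hp1.le hq0.le hq1.le) id]
  · simp [Finset.filter_eq']
  · intro a a' _ _
    refine ⟨fun h => ?_, fun h => congrArg _ h⟩
    have h0 := congrFun h 0
    have h1 := congrFun h 1
    fin_cases a <;> fin_cases a' <;> simp [reverseHeraldTransition] at h0 h1 ⊢ <;> grind

lemma classicalComplexity_lt_timeReversal (hp0 : 0 < p) (hp1 : p < 1) (hq0 : 0 < q)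
    (hq1 : q < 1) (hν : IsPerturbedCoin p q ν) :
    classicalComplexity (heraldingCoin ν) <
      classicalComplexity (timeReversal (heraldingCoin ν)) := by
  have hpq : 0 < p + q := by positivity
  have hp1' : 0 < 1 - p := by linarith
  rw [classicalComplexity_heraldingCoin hp0.le hp1.le hq0.le hq1.le hpq hν,
    classicalComplexity_timeReversal_heraldingCoin hp0 hp1 hq0 hq1 hν]
  have h := eta_add_lt (a := q * (1 - p) / (p + q)) (b := p * q / (p + q)) (by positivity)
    (by positivity)
  have e : 1 - p / (p + q) = q * (1 - p) / (p + q) + p * q / (p + q) := by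
    field_simp
    ring
  have hlt : binEnt (p / (p + q)) < ∑ a, eta (heraldStationary p q a) := by
    rw [binEnt, e, Fin.sum_univ_three]
    simp only [heraldStationary, Matrix.cons_val_zero, Matrix.cons_val_one, Matrix.cons_val]
    linarith
  refine (ENNReal.ofReal_lt_ofReal_iff ?_).2 hlt
  exact (binEnt_nonneg (by positivity) (by rw [div_le_one hpq]; linarith)).trans_lt hlt

end Classical

/-! ### The quantum models of the heralding coin and of its time reversal -/

section Quantum

variable {p q : ℝ}

/-- The memory states of `forwardModel`, as a function of the last symbol. -/
noncomputable def ketForward (p q : ℝ) (a : Fin 3) : EuclideanSpace ℂ (Fin 3) :=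
  if a = 1 then ketForward1 q else ketForward0 p

lemma ketForward_eq (a : Fin 3) : ketForward p q a =
    WithLp.toLp 2 fun x => ((√(heraldTransition p q a x) : ℝ) : ℂ) := by
  ext i
  fin_cases a <;> fin_cases i <;>
    simp [ketForward, ketForward0, ketForward1, ket, heraldTransition]

lemma ketBackward_eq (a : Fin 3) : ketBackward q a =
    WithLp.toLp 2 fun x => ((![![1, √q, 0] a, ![0, √(1 - q), 1] a] x : ℝ) : ℂ) := by
  ext i
  fin_cases a <;> fin_cases i <;> simp [ketBackward, ket]

lemma inner_ofReal_vector {n : ℕ} (v w : Fin n → ℝ) :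
    ⟪(WithLp.toLp 2 fun x => (v x : ℂ) : EuclideanSpace ℂ (Fin n)),
      WithLp.toLp 2 fun x => (w x : ℂ)⟫_ℂ = ((∑ x, v x * w x : ℝ) : ℂ) := by
  simp [PiLp.inner_apply, mul_comm]

lemma coinC_eq (hpq : p + q ≠ 0) :
    coinC p q = 1 - 4 * (p * q * (1 - p + p * q) / (p + q) ^ 2) := by
  rw [coinC]
  field_simp
  ring

lemma sum_heraldTransition (a : Fin 3) : ∑ x, heraldTransition p q a x = 1 := by
  fin_cases a <;> simp [heraldTransition, Fin.sum_univ_three]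

/-- The amplitudes of the memory states are the square roots of the transition probabilities, so
that their overlaps are the Bhattacharyya coefficients of the next outputs. -/
lemma forwardModel_isOptimal (hp0 : 0 ≤ p) (hp1 : p ≤ 1) (hq0 : 0 ≤ q) (hq1 : q ≤ 1)
    (hpq : 0 < p + q) {P : Measure (ℤ → Fin 3)} [IsProbabilityMeasure P]
    (hP : IsMarkovLaw (heraldStationary p q) (heraldTransition p q) P) :
    (forwardModel p q).IsOptimal P ∧ (forwardModel p q).entropy P =
      ENNReal.ofReal (binEnt ((1 + √(coinC p q)) / 2)) := by
  have hp1' : 0 ≤ 1 - p := by linarith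
  have hq1' : 0 ≤ 1 - q := by linarith
  have hπ := heraldStationary_nonneg hp0 hp1 hq0
  have hT := heraldTransition_nonneg hp0 hp1 hq0 hq1
  have hS : ∀ a, ‖ketForward p q a‖ = 1 := by
    intro a
    rw [← sq_eq_sq₀ (norm_nonneg _) zero_le_one, EuclideanSpace.norm_sq_eq, ketForward_eq, one_pow,
      ← sum_heraldTransition (p := p) (q := q) a]
    refine Finset.sum_congr rfl fun x _ => ?_
    simp [Real.sq_sqrt (hT a x)]
  have hunique : Unique (forwardModel p q).Index := inferInstanceAs (Unique Unit)
  have hmodel : (forwardModel p q).IsModel P := by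
    refine hP.isModel hπ hT hS (fun y => rfl) (fun x k a => ?_) (fun ψ => ?_)
    · change ketBra (ketForward p q x) (ket x) (ketForward p q a) = _
      rw [ketBra_apply, ket, EuclideanSpace.inner_single_left, ketForward_eq a]
      simp
    · rw [EuclideanSpace.norm_sq_eq]
      refine Finset.sum_congr rfl fun x _ => ?_
      change ‖ketBra (ketForward p q x) (ket x) ψ‖ ^ 2 = _
      rw [ketBra_apply, norm_smul, hS, ket, EuclideanSpace.inner_single_left]
      simp
  rw [coinC_eq hpq.ne']
  -- `κ` is the overlap of the two memory states
  obtain ⟨κ, hκ⟩ : ∃ κ, κ = √p * √(1 - q) := ⟨_, rfl⟩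
  have hκ2 : κ ^ 2 = p * (1 - q) := by rw [hκ, mul_pow, Real.sq_sqrt hp0, Real.sq_sqrt hq1']
  have hκ1 : 0 ≤ 1 - κ ^ 2 := by rw [hκ2]; nlinarith
  obtain ⟨σ, hσ⟩ : ∃ σ, σ ^ 2 = 1 - κ ^ 2 := ⟨√(1 - κ ^ 2), Real.sq_sqrt hκ1⟩
  have hGram : ∀ a b, ∑ x, √(heraldTransition p q a x) * √(heraldTransition p q b x) =
      ![1, κ, 1] a * ![1, κ, 1] b + ![0, σ, 0] a * ![0, σ, 0] b := by
    have h1 := Real.mul_self_sqrt hp0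
    have h2 := Real.mul_self_sqrt hp1'
    have h3 := Real.mul_self_sqrt hq0
    have h4 := Real.mul_self_sqrt hq1'
    intro a b
    fin_cases a <;> fin_cases b <;> simp [heraldTransition, Fin.sum_univ_three] <;> grind
  refine hP.isOptimal_and_entropy_eq hπ (sum_heraldStationary hpq.ne') hT hS hmodel
    (fun y => rfl) (V := Submodule.span ℂ (Set.range ![ketForward0 p, ketForward1 q]))
    ((finrank_range_le_card _).trans (by simp)) (fun a => Submodule.subset_span ?_)
    (s₁ := ![1, κ, 1]) (s₂ := ![0, σ, 0]) (fun a => ?_) (fun a b => ?_) (fun a b => ?_) ?_ ?_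
  · by_cases h : a = 1
    · exact ⟨1, by simp [ketForward, h]⟩
    · exact ⟨0, by simp [ketForward, h]⟩
  · fin_cases a <;> simp [hσ]
  · rw [← hGram]
    exact Finset.sum_congr rfl fun x _ => Real.sqrt_mul (hT _ _) _
  · rw [← hGram, ketForward_eq, ketForward_eq]
    exact inner_ofReal_vector _ _
  · have : 0 ≤ 1 - p + p * q := by positivity
    positivity
  · simp only [Fin.sum_univ_three, heraldStationary, Matrix.cons_val_zero, Matrix.cons_val_one,
      Matrix.cons_val]
    have e : ∀ a b c : ℝ, (a * 1 ^ 2 + b * κ ^ 2 + c * 1 ^ 2) *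
        (a * 0 ^ 2 + b * σ ^ 2 + c * 0 ^ 2) - (a * (1 * 0) + b * (κ * σ) + c * (1 * 0)) ^ 2 =
        (a + b * κ ^ 2 + c) * (b * σ ^ 2) - b ^ 2 * κ ^ 2 * σ ^ 2 := fun a b c => by ring
    rw [e, hσ, hκ2]
    field_simp
    ring

/-- The memory is a qubit, and again the overlaps of the memory states equal the Bhattacharyya
coefficients of the next outputs. -/
lemma backwardModel_isOptimal (hp0 : 0 ≤ p) (hp1 : p ≤ 1) (hq0 : 0 ≤ q) (hq1 : q ≤ 1)
    (hpq : 0 < p + q) {P : Measure (ℤ → Fin 3)} [IsProbabilityMeasure P]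
    (hP : IsMarkovLaw (heraldStationary p q) (reverseHeraldTransition p q) P) :
    (backwardModel p q).IsOptimal P ∧ (backwardModel p q).entropy P =
      ENNReal.ofReal (binEnt ((1 + √(coinC p q)) / 2)) := by
  have hp1' : 0 ≤ 1 - p := by linarith
  have hq1' : 0 ≤ 1 - q := by linarith
  have hπ := heraldStationary_nonneg hp0 hp1 hq0
  have hT := reverseHeraldTransition_nonneg hp0 hp1 hq0 hq1
  have h1 := Real.mul_self_sqrt hp0
  have h2 := Real.mul_self_sqrt hp1'
  have h3 := Real.mul_self_sqrt hq0
  have h4 := Real.mul_self_sqrt hq1'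
  have hS : ∀ a, ‖ketBackward q a‖ = 1 := by
    intro a
    rw [← sq_eq_sq₀ (norm_nonneg _) zero_le_one, EuclideanSpace.norm_sq_eq, ketBackward_eq, one_pow]
    fin_cases a <;> simp [Fin.sum_univ_two, Real.sq_sqrt, *]
  have hunique : Unique (backwardModel p q).Index := inferInstanceAs (Unique Unit)
  have hkraus : ∀ x k ψ, (backwardModel p q).kraus x k ψ =
      (![(√(1 - p) : ℂ) * ψ 0, ψ 1, (√p : ℂ) * ψ 0] x : ℂ) • ketBackward q x := by
    intro x k ψ
    fin_cases x <;>
      simp [backwardModel, ketBra_apply, ket, EuclideanSpace.inner_single_left, mul_smul]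
  have hmodel : (backwardModel p q).IsModel P := by
    refine hP.isModel hπ hT hS (fun y => rfl) (fun x k a => ?_) (fun ψ => ?_)
    · rw [hkraus, ketBackward_eq a]
      congr 1
      fin_cases a <;> fin_cases x <;>
        simp [reverseHeraldTransition, Real.sqrt_mul, mul_comm, *]
    · simp only [hkraus, norm_smul, hS, mul_one]
      rw [EuclideanSpace.norm_sq_eq, Fin.sum_univ_three, Fin.sum_univ_two]
      simp only [Matrix.cons_val_zero, Matrix.cons_val_one, Matrix.cons_val, norm_mul,
        Complex.norm_real, Real.norm_of_nonneg (Real.sqrt_nonneg _), mul_pow, Real.sq_sqrt hp0,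
        Real.sq_sqrt hp1']
      ring
  rw [coinC_eq hpq.ne']
  have hGram : ∀ a b,
      ∑ x, √(reverseHeraldTransition p q a x) * √(reverseHeraldTransition p q b x) =
      ![1, √q, 0] a * ![1, √q, 0] b + ![0, √(1 - q), 1] a * ![0, √(1 - q), 1] b := by
    intro a b
    fin_cases a <;> fin_cases b <;>
      simp [reverseHeraldTransition, Fin.sum_univ_three, Real.sqrt_mul, hp0, hq0] <;> grind
  refine hP.isOptimal_and_entropy_eq hπ (sum_heraldStationary hpq.ne') hT hS hmodel
    (fun y => rfl) (V := ⊤) (by simp) (fun a => Submodule.mem_top)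
    (s₁ := ![1, √q, 0]) (s₂ := ![0, √(1 - q), 1]) (fun a => ?_) (fun a b => ?_)
    (fun a b => ?_) ?_ ?_
  · fin_cases a <;> simp [Real.sq_sqrt, *]
  · rw [← hGram]
    exact Finset.sum_congr rfl fun x _ => Real.sqrt_mul (hT _ _) _
  · rw [ketBackward_eq, ketBackward_eq, inner_ofReal_vector, Fin.sum_univ_two]
    rfl
  · have : 0 ≤ 1 - p + p * q := by positivity
    positivity
  · simp only [Fin.sum_univ_three, heraldStationary, Matrix.cons_val_zero, Matrix.cons_val_one,
      Matrix.cons_val]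
    have e : ∀ a b c : ℝ, (a * 1 ^ 2 + b * √q ^ 2 + c * 0 ^ 2) *
        (a * 0 ^ 2 + b * √(1 - q) ^ 2 + c * 1 ^ 2) -
          (a * (1 * 0) + b * (√q * √(1 - q)) + c * (0 * 1)) ^ 2 =
        (a + b * √q ^ 2) * (b * √(1 - q) ^ 2 + c) - b ^ 2 * √q ^ 2 * √(1 - q) ^ 2 :=
      fun a b c => by ring
    rw [e, Real.sq_sqrt hq0, Real.sq_sqrt hq1']
    field_simp
    ring

end Quantum

theorem mainTheorem1 :
    (∃ (P : Measure (ℤ → Fin 3)) (_ : IsProbabilityMeasure P), IsStationaryLaw P ∧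
      classicalComplexity P ≠ classicalComplexity (timeReversal P) ∧
      quantumComplexity P = quantumComplexity (timeReversal P)) ∧
    ∀ p q : ℝ, 0 ≤ p → p ≤ 1 → 0 ≤ q → q ≤ 1 → 0 < p + q →
      (∃ ν : Measure (ℤ → Fin 2), IsProbabilityMeasure ν ∧ IsPerturbedCoin p q ν) ∧
      ∀ (ν : Measure (ℤ → Fin 2)) [IsProbabilityMeasure ν], IsPerturbedCoin p q ν →
        classicalComplexity (heraldingCoin ν) = ENNReal.ofReal (binEnt (p / (p + q))) ∧
        (0 < p → p < 1 → 0 < q → q < 1 →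
          classicalComplexity (heraldingCoin ν) <
            classicalComplexity (timeReversal (heraldingCoin ν)) ∧
          classicalComplexity (timeReversal (heraldingCoin ν)) < ⊤) ∧
        (forwardModel p q).IsOptimal (heraldingCoin ν) ∧
        (backwardModel p q).IsOptimal (timeReversal (heraldingCoin ν)) ∧
        (forwardModel p q).entropy (heraldingCoin ν) =
          ENNReal.ofReal (binEnt ((1 + √(coinC p q)) / 2)) ∧
        (backwardModel p q).entropy (timeReversal (heraldingCoin ν)) =
          ENNReal.ofReal (binEnt ((1 + √(coinC p q)) / 2)) ∧
        quantumComplexity (heraldingCoin ν) =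
          ENNReal.ofReal (binEnt ((1 + √(coinC p q)) / 2)) ∧
        quantumComplexity (timeReversal (heraldingCoin ν)) =
          ENNReal.ofReal (binEnt ((1 + √(coinC p q)) / 2)) := by
  have main : ∀ p q : ℝ, 0 ≤ p → p ≤ 1 → 0 ≤ q → q ≤ 1 → 0 < p + q →
      ∀ (ν : Measure (ℤ → Fin 2)) [IsProbabilityMeasure ν], IsPerturbedCoin p q ν →
        classicalComplexity (heraldingCoin ν) = ENNReal.ofReal (binEnt (p / (p + q))) ∧
        (0 < p → p < 1 → 0 < q → q < 1 →
          classicalComplexity (heraldingCoin ν) <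
            classicalComplexity (timeReversal (heraldingCoin ν)) ∧
          classicalComplexity (timeReversal (heraldingCoin ν)) < ⊤) ∧
        (forwardModel p q).IsOptimal (heraldingCoin ν) ∧
        (backwardModel p q).IsOptimal (timeReversal (heraldingCoin ν)) ∧
        (forwardModel p q).entropy (heraldingCoin ν) =
          ENNReal.ofReal (binEnt ((1 + √(coinC p q)) / 2)) ∧
        (backwardModel p q).entropy (timeReversal (heraldingCoin ν)) =
          ENNReal.ofReal (binEnt ((1 + √(coinC p q)) / 2)) ∧
        quantumComplexity (heraldingCoin ν) =
          ENNReal.ofReal (binEnt ((1 + √(coinC p q)) / 2)) ∧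
        quantumComplexity (timeReversal (heraldingCoin ν)) =
          ENNReal.ofReal (binEnt ((1 + √(coinC p q)) / 2)) := by
    intro p q hp0 hp1 hq0 hq1 hpq ν _ hν
    have hP := hν.isMarkovLaw_heraldingCoin hp0 hp1 hq0 hq1 hpq
    have hP' := hP.timeReversal heraldStationary_mul_reverse
    obtain ⟨hf, hfe⟩ := forwardModel_isOptimal hp0 hp1 hq0 hq1 hpq hP
    obtain ⟨hb, hbe⟩ := backwardModel_isOptimal hp0 hp1 hq0 hq1 hpq hP'
    refine ⟨classicalComplexity_heraldingCoin hp0 hp1 hq0 hq1 hpq hν, fun h1 h2 h3 h4 =>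
      ⟨classicalComplexity_lt_timeReversal h1 h2 h3 h4 hν, ?_⟩, hf, hb, hfe, hbe,
      hf.quantumComplexity_eq.trans hfe, hb.quantumComplexity_eq.trans hbe⟩
    rw [classicalComplexity_timeReversal_heraldingCoin h1 h2 h3 h4 hν]
    exact ENNReal.ofReal_lt_top
  refine ⟨?_, fun p q hp0 hp1 hq0 hq1 hpq =>
    ⟨exists_isPerturbedCoin hp0 hp1 hq0 hq1 hpq, main p q hp0 hp1 hq0 hq1 hpq⟩⟩
  -- the heralding coin with two fair coins is asymmetric classically, but not quantum mechanically
  obtain ⟨ν, _, hν⟩ := exists_isPerturbedCoin (p := 1 / 2) (q := 1 / 2) (by norm_num) (by norm_num)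
    (by norm_num) (by norm_num) (by norm_num)
  have hP := hν.isMarkovLaw_heraldingCoin (by norm_num) (by norm_num) (by norm_num) (by norm_num)
    (by norm_num)
  obtain ⟨-, hlt, -, -, -, -, hq, hq'⟩ := main (1 / 2) (1 / 2) (by norm_num) (by norm_num)
    (by norm_num) (by norm_num) (by norm_num) ν hν
  exact ⟨heraldingCoin ν, inferInstance, hP.isStationaryLaw,
    (hlt (by norm_num) (by norm_num) (by norm_num) (by norm_num)).1.ne, hq.trans hq'.symm⟩
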